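/- Let $r\ge 1$, $G=SL_{r+1}(\mathbb C)$, let $H$ be the diagonal torus, $B=HN$, $B^-=HN^-$ the Borel subgroups of upper and lower triangular matrices ($N$, $N^-$ unitriangular), and $G_0=N^-HN$, with $x=[x]_-[x]_0[x]_+$ the corresponding factorization of $x\in G_0$. Let $E_{a,b}$ be the matrix units, $x_i(t)=1+tE_{i,i+1}$, $y_i(t)=1+tE_{i+1,i}$, $\overline{s_i}=x_i(-1)y_i(1)x_i(-1)$ $(1\le i\le r)$, and $\overline w=\overline{s_{j_1}}\cdots\overline{s_{j_k}}$ for a reduced word $(j_1,\dots,j_k)$ of a Weyl group element $w$. Let $(a_{i,j})$ be the Cartan matrix of type $A_r$, $n=r(r+1)/2$, and let $$\mathbf i_0=(i_1,\dots,i_n)=(1,2,\dots,r,\;1,2,\dots,r-1,\;\dots,\;1,2,\;1),$$ a reduced word of the longest element $w_0$. Put $I=\{-r,\dots,-1\}\cup\{1,\dots,n\}$, $i_{-k}=-k$ for $1\le k\le r$, $k^+=\min(\{l\in I: l>k,\ |i_l|=|i_k|\}\cup\{n+1\})$, $w_{\le k}=s_{i_1}\cdots s_{i_k}$ for $k\ge1$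 and $w_{\le k}=e$ for $k<0$. Let $\mathcal A=(\mathbb C^\times)^I$, with coordinates $A_k$. *The cell and the crystal action.* Let $G^{w_0,e}=B\overline{w_0}B\cap B^-$. For $1\le j\le r$ and $x=nh\in G^{w_0,e}$ $(n\in N^-,h\in H)$ let $\gamma_j(x)=h_{j,j}/h_{j+1,j+1}$, $\chi_j(x)=n_{j+1,j}$, $\varphi_j=1/\chi_j$ and $\varepsilon_j=\varphi_j/\gamma_j$. For $c\in\mathbb C^\times$ let $e_j^c$ be the rational map of $G^{w_0,e}$ to itself $$e_j^c(x)=x_j\big((c-1)\varphi_j(x)\big)\,x\,x_j\big((c^{-1}-1)\varepsilon_j(x)\big).$$ *The twist.* Let $\theta$ be the automorphism of $G$ with $\theta(h)=h^{-1}$ for $h\in H$, $\theta(x_i(t))=y_i(t)$, $\theta(y_i(t))=x_i(t)$, let $\iota$ be the antiautomorphism of $G$ with $\iota(h)=h^{-1}$ for $h\in H$, $\iota(x_i(t))=x_i(t)$, $\iota(y_i(t))=y_i(t)$, and let $\zeta(x)=\theta\big([\overline{w_0}^{-1}x]_-^{-1}\,\overline{w_0}^{-1}x\big)$ for $x\in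 G^{w_0,e}$. *The cluster chart.* Let $a:\mathcal A\to G^{w_0,e}$ be the map such that $a(A)$ is the unique point of $G^{w_0,e}$ at which, for each $k\in I$, the generalized minor $\Delta_{w_{\le k}\Lambda_{|i_k|},\Lambda_{|i_k|}}$ takes the value $A_k$; here $\Delta_{w\Lambda_i,\Lambda_i}(x)$ is the upper left $i\times i$ minor of $\overline w^{-1}x$. *The map $p$.* With $[P]=1$ if $P$ is true and $[P]=0$ otherwise, let $\widetilde B=(\widetilde B_{j,k})_{j,k\in I}$ be the integer matrix $$\widetilde B_{j,k}=\frac{a_{|i_k|,|i_j|}}2\Big(-[j=k^+]+[j^+=k]-[k<j<k^+][j>0]+[k<j^+<k^+][j^+\le n]+[j<k<j^+][k>0]-[j<k^+<j^+][k^+\le n]+[j^+,k^+>n]+[j,k<0]\Big),$$ and for $A\in\mathcal A$ let $P=p(A)\in(\mathbb C^\times)^I$ be given by $P_k=\prod_{l\in I}A_l^{\widetilde B_{k,l}}$. For $1\le m\le r$ and $1\le d\le r-m+1$ write $A_{m,d}$, $P_{m,d}$ for the coordinates $A_k$, $P_k$ at the place $k=d+\sum_{l=1}^{m-1}(r-l+1)$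 of the $d$-th letter of the $m$-th cycle of $\mathbf i_0$. **Theorem.** Let $1\le j\le r$ and $c\in\mathbb C^\times$. The composition $$F_j^c=a^{-1}\circ(\iota\circ\zeta)^{-1}\circ e_j^c\circ(\iota\circ\zeta)\circ a$$ is a rational map from $\mathcal A$ to itself: it is defined on a set that contains a nonempty Zariski open subset of $\mathcal A$. At each point $A$ where the composition is defined, and for all $1\le m\le r$ and $1\le d\le r-m+1$, one has $F_j^c(A)_{m,d}=A_{m,d}$ if $j\ne d$, and if $j=d$ then $$F_j^c(A)_{m,d}=A_{m,d}\cdot\frac{c\sum_{s=1}^{m}P_{s,d}P_{s+1,d}\cdots P_{r-d,d}+\sum_{s=m+1}^{r-d+1}P_{s,d}P_{s+1,d}\cdots P_{r-d,d}}{\sum_{s=1}^{r-d+1}P_{s,d}P_{s+1,d}\cdots P_{r-d,d}},$$ where the product for $s=r-d+1$ is empty, equal to $1$, and the denominator does not vanish. -/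

import Mathlib

namespace GeoCrystal

/-! ### The group and its standard subgroups

The index set `[1, r]` of the simple roots is `Fin r`, so that the letter `i : Fin r` stands for the
index `i + 1` of the usual `1`-based numbering. -/

/-- The group `SL_{r+1}(ℂ)`. -/
abbrev G (r : ℕ) : Type := Matrix.SpecialLinearGroup (Fin (r + 1)) ℂ

variable {r : ℕ}

/-- `x_i(t) = exp (t e_i)`, where `e_i` is the matrix unit at the place `(i, i + 1)`. -/
noncomputable def xRoot (i : Fin r) (t : ℂ) : G r :=
  Matrix.SpecialLinearGroup.transvection (Fin.castSucc_lt_succ (i := i)).ne t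

/-- `y_i(t) = exp (t f_i)`, where `f_i` is the matrix unit at the place `(i + 1, i)`. -/
noncomputable def yRoot (i : Fin r) (t : ℂ) : G r :=
  Matrix.SpecialLinearGroup.transvection (Fin.castSucc_lt_succ (i := i)).ne' t

/-- The maximal torus `H` of diagonal matrices. -/
def torus (r : ℕ) : Set (G r) := {g | ∀ i j, i ≠ j → g i j = 0}

/-- The group `N` of upper unitriangular matrices. -/
def upperN (r : ℕ) : Set (G r) := {g | (∀ i j, j < i → g i j = 0) ∧ ∀ i, g i i = 1}

/-- The group `N⁻` of lower unitriangular matrices. -/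
def lowerN (r : ℕ) : Set (G r) := {g | (∀ i j, i < j → g i j = 0) ∧ ∀ i, g i i = 1}

/-- The Borel subgroup `B = HN` of upper triangular matrices. -/
def upperB (r : ℕ) : Set (G r) := {g | ∀ i j, j < i → g i j = 0}

/-- The Borel subgroup `B⁻ = HN⁻` of lower triangular matrices. -/
def lowerB (r : ℕ) : Set (G r) := {g | ∀ i j, i < j → g i j = 0}

/-- The representative `x_i(-1) y_i(1) x_i(-1)` of the simple reflection `s_i`. -/
noncomputable def sBar (i : Fin r) : G r := xRoot i (-1) * yRoot i 1 * xRoot i (-1)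

/-- The representative of the Weyl group element with the given reduced word. -/
noncomputable def wordBar (word : List (Fin r)) : G r := (word.map sBar).prod

/-- The double Bruhat cell `B u B ∩ B⁻ v B⁻`, for representatives `u`, `v`. -/
def doubleBruhatCell (u v : G r) : Set (G r) :=
  {x | (∃ b ∈ upperB r, ∃ b' ∈ upperB r, x = b * u * b') ∧
    ∃ b ∈ lowerB r, ∃ b' ∈ lowerB r, x = b * v * b'}

/-- The cell `G^{u,e}`, where `u` has the given reduced word. -/
noncomputable def cell (word : List (Fin r)) : Set (G r) := doubleBruhatCell (wordBar word) 1

/-- The open subset `G₀ = N⁻ H N`. -/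
def gaussSet (r : ℕ) : Set (G r) :=
  {x | ∃ a ∈ lowerN r, ∃ h ∈ torus r, ∃ b ∈ upperN r, x = a * h * b}

/-- The factor `[x]₋ ∈ N⁻` of the (unique) decomposition `x = [x]₋ [x]₀ [x]₊` of `x ∈ G₀`. -/
noncomputable def gaussMinus (x : G r) (hx : x ∈ gaussSet r) : G r := hx.choose

/-! ### The geometric crystal on `G^{u,e}` -/

/-- `γ_i(x)`: the value of the simple root `α_i` at the `H`-component of `x ∈ B⁻ = N⁻ H`, see
`gamma_mul`. -/
noncomputable def gamma (i : Fin r) (x : G r) : ℂ := x i.castSucc i.castSucc / x i.succ i.succ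

/-- `χ_i(x)` for `x ∈ B⁻ = N⁻ H`: the number `z` such that the projection of the `N⁻`-component of `x`
to the first factor of `N⁻ = N_{-α_i} · (N⁻ ∩ s_i N⁻ s_i⁻¹)` is `y_i(z)`, see `chi_mul` and
`exists_chi`. -/
noncomputable def chi (i : Fin r) (x : G r) : ℂ := x i.succ i.castSucc / x i.castSucc i.castSucc

/-- `φ_i = 1 / χ_i`. -/
noncomputable def phi (i : Fin r) (x : G r) : ℂ := (chi i x)⁻¹

/-- `ε_i = φ_i / γ_i`. -/
noncomputable def eps (i : Fin r) (x : G r) : ℂ := phi i x / gamma i x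

/-- The rational action `e_j^c(x) = x_j((c - 1) φ_j(x)) x x_j((c⁻¹ - 1) ε_j(x))` on `G^{u,e}`, as a
partial function. It is undefined exactly where `χ_j` vanishes. (The word of `u` is supposed to
contain every letter, so that `χ_j` is not identically zero on `G^{u,e}`.) -/
noncomputable def crystalAction (word : List (Fin r)) (j : Fin r) (c : ℂˣ) : G r →. G r := fun x =>
  ⟨x ∈ cell word ∧ chi j x ≠ 0, fun _ =>
    xRoot j (((c : ℂ) - 1) * phi j x) * x * xRoot j (((c : ℂ)⁻¹ - 1) * eps j x)⟩

/-! ### The twist -/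

/-- The diagonal sign matrix with entries `1, -1, 1, …`. -/
def signMatrix (r : ℕ) : Matrix (Fin (r + 1)) (Fin (r + 1)) ℂ :=
  Matrix.diagonal fun i => (-1) ^ (i : ℕ)

theorem signMatrix_mul_self (r : ℕ) : signMatrix r * signMatrix r = 1 := by
  rw [signMatrix, Matrix.diagonal_mul_diagonal, ← Matrix.diagonal_one]
  congr 1
  funext i
  rw [← mul_pow]
  norm_num

/-- Conjugation by the sign matrix. -/
def signConj (g : G r) : G r :=
  ⟨signMatrix r * g.1 * signMatrix r, by
    have h : (signMatrix r).det * (signMatrix r).det = 1 := by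
      rw [← Matrix.det_mul, signMatrix_mul_self, Matrix.det_one]
    rw [Matrix.det_mul, Matrix.det_mul, g.2, mul_one, h]⟩

/-- The automorphism `θ` of `G` with `θ(a) = a⁻¹` on `H`, `θ(x_i(t)) = y_i(t)` and
`θ(y_i(t)) = x_i(t)`. -/
def theta (g : G r) : G r := signConj (g⁻¹).transpose

/-- The antiautomorphism `ι` of `G` with `ι(a) = a⁻¹` on `H`, `ι(x_i(t)) = x_i(t)` and
`ι(y_i(t)) = y_i(t)`. -/
def iota (g : G r) : G r := signConj g⁻¹

/-- The twist map `ζ^{u,e}(x) = θ([u⁻¹ x]₋⁻¹ u⁻¹ x)` on `G^{u,e}`, as a partial function. -/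
noncomputable def zeta (word : List (Fin r)) : G r →. G r := fun x =>
  ⟨x ∈ cell word ∧ (wordBar word)⁻¹ * x ∈ gaussSet r, fun h =>
    theta ((gaussMinus ((wordBar word)⁻¹ * x) h.2)⁻¹ * ((wordBar word)⁻¹ * x))⟩

/-- The map `ι ∘ ζ^{u,e}` on `G^{u,e}`. -/
noncomputable def twist (word : List (Fin r)) : G r →. G r := fun x => (zeta word x).map iota

/-- The inverse of a partial function, defined at the points with exactly one preimage. -/
noncomputable def partialInverse {α β : Type} (f : α →. β) : β →. α := fun b =>
  ⟨∃! a, b ∈ f a, fun h => h.choose⟩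

/-! ### The cluster tori of a reduced word -/

/-- The index set `I = {-r, …, -1} ∪ {1, …, n}` of the seed of a word of length `n`. The index
`-i` is `Sum.inl` of the letter `i`, the index `k ≥ 1` is `Sum.inr (k - 1)`. -/
abbrev SeedIndex (word : List (Fin r)) : Type := Fin r ⊕ Fin word.length

/-- The index as an integer in `{-r, …, -1} ∪ {1, …, n}`. -/
def num (word : List (Fin r)) : SeedIndex word → ℤ
  | Sum.inl i => -((i : ℤ) + 1)
  | Sum.inr k => (k : ℤ) + 1

/-- The letter `|i_k|`. -/
def letter (word : List (Fin r)) : SeedIndex word → Fin r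
  | Sum.inl i => i
  | Sum.inr k => word.get k

/-- `k⁺ = min ({l ∈ I | l > k, |i_l| = |i_k|} ∪ {n + 1})`. -/
def succIdx (word : List (Fin r)) (k : SeedIndex word) : ℤ :=
  (insert ((word.length : ℤ) + 1)
    ((Finset.univ.filter fun l => num word k < num word l ∧ letter word l = letter word k).image
      (num word))).min' (Finset.insert_nonempty _ _)

/-- The bracket `[P]`. -/
def bracket (P : Prop) [Decidable P] : ℚ := if P then 1 else 0

/-- The exchange matrix of the seed of a word. -/
def exchangeMatrix (word : List (Fin r)) (j k : SeedIndex word) : ℚ :=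
  let a : ℚ := CartanMatrix.A r (letter word k) (letter word j)
  let n : ℤ := word.length
  let j₀ := num word j
  let k₀ := num word k
  let j₁ := succIdx word j
  let k₁ := succIdx word k
  a / 2 * (-bracket (j₀ = k₁) + bracket (j₁ = k₀)
    - bracket (k₀ < j₀ ∧ j₀ < k₁) * bracket (0 < j₀)
    + bracket (k₀ < j₁ ∧ j₁ < k₁) * bracket (j₁ ≤ n)
    + bracket (j₀ < k₀ ∧ k₀ < j₁) * bracket (0 < k₀)
    - bracket (j₀ < k₁ ∧ k₁ < j₁) * bracket (k₁ ≤ n))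

/-- The matrix `M`, which vanishes unless both indices are frozen. -/
def frozenMatrix (word : List (Fin r)) (j k : SeedIndex word) : ℚ :=
  let a : ℚ := CartanMatrix.A r (letter word k) (letter word j)
  let n : ℤ := word.length
  a / 2 * (bracket (n < succIdx word j ∧ n < succIdx word k)
    + bracket (num word j < 0 ∧ num word k < 0))

/-- The matrix `B + M`. Its entries are integers, see `extendedMatrix_eq_floor`. -/
def extendedMatrix (word : List (Fin r)) (j k : SeedIndex word) : ℚ :=
  exchangeMatrix word j k + frozenMatrix word j k

/-- The map `p = p_M` from the cluster `𝒜`-torus to the cluster `𝒳`-torus, with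
`p(A)_i = ∏_k A_k ^ (B + M)_{i,k}`. -/
def ensembleMap (word : List (Fin r)) (A : SeedIndex word → ℂˣ) : SeedIndex word → ℂˣ := fun i =>
  ∏ k, A k ^ ⌊extendedMatrix word i k⌋

/-- The principal minor `Δ_{Λ_i, Λ_i}`: the determinant of the upper left block of size `i` (in the
`1`-based numbering), see `principalMinor_gauss`. -/
def principalMinor (i : Fin r) (x : G r) : ℂ :=
  (x.1.submatrix (Fin.castLE (by omega : (i : ℕ) + 1 ≤ r + 1))
    (Fin.castLE (by omega : (i : ℕ) + 1 ≤ r + 1))).det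

/-- The generalized minor `Δ_{w' Λ_i, w Λ_i}`, for representatives `w'`, `w`. -/
noncomputable def generalizedMinor (w' w : G r) (i : Fin r) (x : G r) : ℂ :=
  principalMinor i (w'⁻¹ * x * w)

/-- The representative of `u_{≤ k} = s_{i_1} ⋯ s_{i_k}`, which is trivial for `k < 0`. -/
noncomputable def prefixBar (word : List (Fin r)) : SeedIndex word → G r
  | Sum.inl _ => 1
  | Sum.inr k => wordBar (word.take ((k : ℕ) + 1))

/-- The function `Δ_{u_{≤ k} Λ_{|i_k|}, Λ_{|i_k|}}`. -/
noncomputable def clusterMinor (word : List (Fin r)) (k : SeedIndex word) (x : G r) : ℂ :=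
  generalizedMinor (prefixBar word k) 1 (letter word k) x

/-- The rational map `a_Σ⁻¹` from `G^{u,e}` to the cluster `𝒜`-torus: its coordinates are the minors
`Δ_{u_{≤ k} Λ_{|i_k|}, Λ_{|i_k|}}`, and it is defined where none of them vanishes. -/
noncomputable def chartInv (word : List (Fin r)) : G r →. (SeedIndex word → ℂˣ) := fun x =>
  ⟨x ∈ cell word ∧ ∀ k, clusterMinor word k x ≠ 0, fun h k => Units.mk0 _ (h.2 k)⟩

/-- The map `a_Σ` from the cluster `𝒜`-torus to `G^{u,e}`: `a_Σ(A)` is the unique point of `G^{u,e}` at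
which the minors `Δ_{u_{≤ k} Λ_{|i_k|}, Λ_{|i_k|}}` take the values `A_k`. -/
noncomputable def chart (word : List (Fin r)) : (SeedIndex word → ℂˣ) →. G r :=
  partialInverse (chartInv word)

/-- The rational map `a_Σ⁻¹ ∘ (ι ∘ ζ^{u,e})⁻¹ ∘ e_j^c ∘ (ι ∘ ζ^{u,e}) ∘ a_Σ` of the cluster `𝒜`-torus,
with the domain of the composition. -/
noncomputable def twistedAction (word : List (Fin r)) (j : Fin r) (c : ℂˣ) :
    (SeedIndex word → ℂˣ) →. (SeedIndex word → ℂˣ) :=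
  (chartInv word).comp <| (partialInverse (twist word)).comp <|
    (crystalAction word j c).comp <| (twist word).comp <| chart word

/-- A partial function on the torus `(ℂˣ)^S` is generically defined if its domain contains a nonempty
principal Zariski open subset. -/
def GenericallyDefined {S β : Type} (f : (S → ℂˣ) →. β) : Prop :=
  ∃ q : MvPolynomial S ℂ, q ≠ 0 ∧
    ∀ A : S → ℂˣ, MvPolynomial.eval (fun k => (A k : ℂ)) q ≠ 0 → (f A).Dom

/-! ### The reduced word of the longest element -/

/-- The word `(1, …, r, 1, …, r - 1, …, 1, 2, 1)`, a reduced word of `w₀`. -/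
def longWord (r : ℕ) : List (Fin r) :=
  (List.finRange r).flatMap fun l : Fin r => (List.finRange (r - (l : ℕ))).map (Fin.castLE (by omega))

/-- The place (counted from `0`) of the `d`-th letter of the `m`-th cycle of `longWord r`, where
`m, d ≥ 1`. -/
def place (r m d : ℕ) : ℕ := (∑ l ∈ Finset.range (m - 1), (r - l)) + (d - 1)

/-- The coordinate `X_{m,d}` of a point of a cluster torus of `longWord r`, for `1 ≤ m`, `1 ≤ d`,
`m + d ≤ r + 1`; the value `1` outside of this range is never used. -/
noncomputable def coord (X : SeedIndex (longWord r) → ℂˣ) (m d : ℕ) : ℂ :=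
  if h : place r m d < (longWord r).length then (X (Sum.inr ⟨place r m d, h⟩) : ℂ) else 1

/-- The product `P_{s,d} P_{s+1,d} ⋯ P_{r-d,d}`, which is `1` for `s = r - d + 1`. -/
noncomputable def tailProd (P : SeedIndex (longWord r) → ℂˣ) (d s : ℕ) : ℂ :=
  ∏ l ∈ Finset.Icc s (r - d), coord P l d


/-! ### Checks of the definitions -/

theorem mul_torus_apply {n h : G r} (hh : h ∈ torus r) (i j : Fin (r + 1)) :
    (n * h) i j = n i j * h j j := by
  rw [Matrix.SpecialLinearGroup.coe_mul, Matrix.mul_apply, Finset.sum_eq_single j]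
  · intro k _ hk
    rw [hh k j hk, mul_zero]
  · simp

/-- `γ_i` is the simple root `α_i`, composed with the projection of `B⁻ = N⁻ H` to `H`. -/
theorem gamma_mul (i : Fin r) {n h : G r} (hn : n ∈ lowerN r) (hh : h ∈ torus r) :
    gamma i (n * h) = h i.castSucc i.castSucc / h i.succ i.succ := by
  simp only [gamma, mul_torus_apply hh, hn.2, one_mul]

theorem yRoot_mul_apply (i : Fin r) (z : ℂ) (g : G r) (a b : Fin (r + 1)) :
    (yRoot i z * g) a b = g a b + if a = i.succ then z * g i.castSucc b else 0 := by
  rw [yRoot, Matrix.SpecialLinearGroup.coe_mul, Matrix.SpecialLinearGroup.transvection_coe, add_mul,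
    one_mul, Matrix.add_apply]
  split_ifs with h
  · subst h; simp
  · simp [h]

theorem xRoot_mul_apply (i : Fin r) (z : ℂ) (g : G r) (a b : Fin (r + 1)) :
    (xRoot i z * g) a b = g a b + if a = i.castSucc then z * g i.succ b else 0 := by
  rw [xRoot, Matrix.SpecialLinearGroup.coe_mul, Matrix.SpecialLinearGroup.transvection_coe, add_mul,
    one_mul, Matrix.add_apply]
  split_ifs with h
  · subst h; simp
  · simp [h]

theorem mul_yRoot_apply (i : Fin r) (z : ℂ) (g : G r) (a b : Fin (r + 1)) :
    (g * yRoot i z) a b = g a b + if b = i.castSucc then z * g a i.succ else 0 := by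
  rw [yRoot, Matrix.SpecialLinearGroup.coe_mul, Matrix.SpecialLinearGroup.transvection_coe, mul_add,
    mul_one, Matrix.add_apply]
  split_ifs with h
  · subst h; simp [mul_comm]
  · simp [h]

theorem mul_xRoot_apply (i : Fin r) (z : ℂ) (g : G r) (a b : Fin (r + 1)) :
    (g * xRoot i z) a b = g a b + if b = i.succ then z * g a i.castSucc else 0 := by
  rw [xRoot, Matrix.SpecialLinearGroup.coe_mul, Matrix.SpecialLinearGroup.transvection_coe, mul_add,
    mul_one, Matrix.add_apply]
  split_ifs with h
  · subst h; simp [mul_comm]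
  · simp [h]

theorem castSucc_ne_succ' (i : Fin r) : i.castSucc ≠ i.succ := (Fin.castSucc_lt_succ (i := i)).ne

theorem sBar_mul_apply (i : Fin r) (g : G r) (a b : Fin (r + 1)) :
    (sBar i * g) a b = if a = i.castSucc then -g i.succ b
      else if a = i.succ then g i.castSucc b else g a b := by
  have h := castSucc_ne_succ' i
  rw [sBar, mul_assoc, mul_assoc]
  simp only [xRoot_mul_apply, yRoot_mul_apply, h.symm, if_true, if_false]
  split_ifs with h1 h2 <;> simp_all

theorem mul_sBar_apply (i : Fin r) (g : G r) (a b : Fin (r + 1)) :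
    (g * sBar i) a b = if b = i.castSucc then g a i.succ
      else if b = i.succ then -g a i.castSucc else g a b := by
  have h := castSucc_ne_succ' i
  rw [sBar, ← mul_assoc, ← mul_assoc]
  simp only [mul_xRoot_apply, mul_yRoot_apply, h, if_true, if_false]
  split_ifs with h1 h2 <;> simp_all

/-- `χ_i` is the coordinate of the first factor of `N⁻ = N_{-α_i} · (N⁻ ∩ s_i N⁻ s_i⁻¹)`, extended to
`B⁻ = N⁻ H`. -/
theorem chi_mul (i : Fin r) (z : ℂ) {n n' h : G r} (hn : n ∈ lowerN r) (hn' : n' ∈ lowerN r)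
    (he : n = sBar i * n' * (sBar i)⁻¹) (hh : h ∈ torus r) : chi i (yRoot i z * n * h) = z := by
  have hne := castSucc_ne_succ' i
  have hlt : i.castSucc < i.succ := Fin.castSucc_lt_succ
  have he' : n * sBar i = sBar i * n' := by rw [he]; group
  have h0 : n i.succ i.castSucc = 0 := by
    have := congrArg (fun g : G r => g i.succ i.succ) he'
    simp only [mul_sBar_apply, sBar_mul_apply, hne.symm, if_true, if_false,
      hn'.1 _ _ hlt] at this
    simpa using this
  have hu : ∀ a b, (yRoot i z * n * h) a b = (yRoot i z * n) a b * h b b := by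
    intro a b
    rw [Matrix.SpecialLinearGroup.coe_mul, Matrix.mul_apply, Finset.sum_eq_single b]
    · intro k _ hk
      rw [hh k b hk, mul_zero]
    · simp
  have hd : h i.castSucc i.castSucc ≠ 0 := by
    have hdet : h.1.det = 1 := h.2
    have : h.1 = Matrix.diagonal fun k => h k k := by
      ext a b
      by_cases hab : a = b
      · subst hab; simp
      · rw [Matrix.diagonal_apply_ne _ hab]; exact hh a b hab
    rw [this, Matrix.det_diagonal] at hdet
    intro h00
    exact zero_ne_one ((Finset.prod_eq_zero (f := fun k => h k k) (Finset.mem_univ i.castSucc)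
      h00).symm.trans hdet)
  simp only [chi, hu, yRoot_mul_apply, h0, hne, hn.2, if_true, if_false]
  field_simp
  ring

theorem yRoot_mem_lowerN (i : Fin r) (z : ℂ) : yRoot i z ∈ lowerN r := by
  have hlt : i.castSucc < i.succ := Fin.castSucc_lt_succ
  have key : ∀ a b, yRoot i z a b = (1 : G r) a b + if a = i.succ then z * (1 : G r) i.castSucc b
      else 0 := by
    intro a b
    rw [← yRoot_mul_apply, mul_one]
  refine ⟨fun a b hab => ?_, fun a => ?_⟩
  · rw [key]
    split_ifs with h
    · subst h
      have h2 : i.castSucc ≠ b := (hlt.trans hab).ne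
      simp [hab.ne, h2]
    · simp [hab.ne]
  · rw [key]
    split_ifs with h
    · subst h
      simp [hlt.ne]
    · simp

/-- Every element of `N⁻` has a decomposition as in `chi_mul`. -/
theorem exists_chi (i : Fin r) {x : G r} (hx : x ∈ lowerN r) :
    ∃ z : ℂ, ∃ n ∈ lowerN r, ∃ n' ∈ lowerN r, n = sBar i * n' * (sBar i)⁻¹ ∧ x = yRoot i z * n := by
  have hne := castSucc_ne_succ' i
  have hlt : i.castSucc < i.succ := Fin.castSucc_lt_succ
  set z := x i.succ i.castSucc with hz
  have hinv : yRoot i z * yRoot i (-z) = 1 := by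
    ext a b
    rw [yRoot_mul_apply]
    have key : ∀ a b, yRoot i (-z) a b = (1 : G r) a b +
        if a = i.succ then (-z) * (1 : G r) i.castSucc b else 0 := by
      intro a b
      rw [← yRoot_mul_apply, mul_one]
    simp only [key, hne, if_false]
    split_ifs <;> ring
  set n : G r := yRoot i (-z) * x with hndef
  have hn : ∀ a b, n a b = x a b + if a = i.succ then (-z) * x i.castSucc b else 0 :=
    fun a b => yRoot_mul_apply i (-z) x a b
  have hnm : n ∈ lowerN r := by
    refine ⟨fun a b hab => ?_, fun a => ?_⟩
    · rw [hn, hx.1 a b hab]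
      split_ifs with h
      · subst h
        rw [hx.1 _ _ (hlt.trans hab)]; ring
      · ring
    · rw [hn, hx.2]
      split_ifs with h
      · subst h
        rw [hx.1 _ _ hlt]; ring
      · ring
  have hn0 : n i.succ i.castSucc = 0 := by
    rw [hn, if_pos rfl, hx.2, ← hz]; ring
  refine ⟨z, n, hnm, (sBar i)⁻¹ * n * sBar i, ?_, by group, ?_⟩
  · set m := (sBar i)⁻¹ * n * sBar i with hm
    have hs : sBar i * m = n * sBar i := by rw [hm]; group
    have e : ∀ a b, (if a = i.castSucc then -m i.succ b
        else if a = i.succ then m i.castSucc b else m a b) =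
        if b = i.castSucc then n a i.succ
        else if b = i.succ then -n a i.castSucc else n a b := by
      intro a b
      rw [← sBar_mul_apply, ← mul_sBar_apply, hs]
    have adj : ∀ a : Fin (r + 1), a < i.succ → a ≠ i.castSucc → a < i.castSucc := by
      intro a h1 h2
      exact lt_of_le_of_ne (Fin.le_castSucc_iff.2 h1) h2
    have adj' : ∀ a : Fin (r + 1), i.castSucc < a → a ≠ i.succ → i.succ < a := by
      intro a h1 h2
      exact lt_of_le_of_ne (Fin.castSucc_lt_iff_succ_le.1 h1) (Ne.symm h2)
    have hrow1 : ∀ b, -m i.succ b = if b = i.castSucc then n i.castSucc i.succ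
        else if b = i.succ then -n i.castSucc i.castSucc else n i.castSucc b := by
      intro b; simpa using e i.castSucc b
    have hrow2 : ∀ b, m i.castSucc b = if b = i.castSucc then n i.succ i.succ
        else if b = i.succ then -n i.succ i.castSucc else n i.succ b := by
      intro b; simpa [hne.symm] using e i.succ b
    have hrow3 : ∀ a b, a ≠ i.castSucc → a ≠ i.succ → m a b = if b = i.castSucc then n a i.succ
        else if b = i.succ then -n a i.castSucc else n a b := by
      intro a b h1 h2; simpa [h1, h2] using e a b
    refine ⟨fun a b hab => ?_, fun a => ?_⟩
    · by_cases h1 : a = i.castSucc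
      · subst h1
        rw [hrow2, if_neg hab.ne']
        split_ifs with h
        · rw [hn0, neg_zero]
        · exact hnm.1 _ _ (adj' b hab h)
      · by_cases h2 : a = i.succ
        · subst h2
          have := hrow1 b
          rw [if_neg (hlt.trans hab).ne', if_neg hab.ne', hnm.1 _ _ (hlt.trans hab)] at this
          exact neg_eq_zero.1 this
        · rw [hrow3 a b h1 h2]
          split_ifs with h3 h4
          · subst h3; exact hnm.1 _ _ (hab.trans hlt)
          · subst h4; rw [hnm.1 _ _ (adj a hab h1), neg_zero]
          · exact hnm.1 _ _ hab
    · by_cases h1 : a = i.castSucc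
      · subst h1
        rw [hrow2, if_pos rfl, hnm.2]
      · by_cases h2 : a = i.succ
        · subst h2
          have := hrow1 i.succ
          rw [if_neg hne.symm, if_pos rfl, hnm.2] at this
          exact neg_inj.1 this
        · rw [hrow3 a a h1 h2, if_neg h1, if_neg h2, hnm.2]
  · rw [hndef, ← mul_assoc, hinv, one_mul]

theorem signConj_mul (g h : G r) : signConj (g * h) = signConj g * signConj h := by
  apply Subtype.ext
  change signMatrix r * (g.1 * h.1) * signMatrix r =
    signMatrix r * g.1 * signMatrix r * (signMatrix r * h.1 * signMatrix r)
  have := signMatrix_mul_self r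
  calc _ = signMatrix r * g.1 * 1 * h.1 * signMatrix r := by simp only [mul_assoc, mul_one]
    _ = signMatrix r * g.1 * (signMatrix r * signMatrix r) * h.1 * signMatrix r := by rw [this]
    _ = _ := by simp only [mul_assoc]

theorem signConj_apply (g : G r) (a b : Fin (r + 1)) :
    signConj g a b = (-1) ^ (a : ℕ) * g a b * (-1) ^ (b : ℕ) := by
  change (signMatrix r * g.1 * signMatrix r) a b = _
  rw [signMatrix, Matrix.mul_diagonal, Matrix.diagonal_mul]

/-- `θ` is multiplicative. -/
theorem theta_mul (g h : G r) : theta (g * h) = theta g * theta h := by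
  have : ((g * h)⁻¹).transpose = (g⁻¹).transpose * (h⁻¹).transpose := by
    rw [mul_inv_rev]
    apply Subtype.ext
    exact Matrix.transpose_mul _ _
  rw [theta, this, signConj_mul, theta, theta]

/-- `ι` reverses products. -/
theorem iota_mul (g h : G r) : iota (g * h) = iota h * iota g := by
  rw [iota, mul_inv_rev, signConj_mul, iota, iota]

theorem xRoot_inv (i : Fin r) (t : ℂ) : (xRoot i t)⁻¹ = xRoot i (-t) := by
  refine inv_eq_of_mul_eq_one_right ?_
  have hne := castSucc_ne_succ' i
  ext a b
  rw [xRoot_mul_apply]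
  have key : ∀ a b, xRoot i (-t) a b = (1 : G r) a b +
      if a = i.castSucc then (-t) * (1 : G r) i.succ b else 0 := by
    intro a b
    rw [← xRoot_mul_apply, mul_one]
  simp only [key, hne.symm, if_false]
  split_ifs <;> ring

theorem yRoot_inv (i : Fin r) (t : ℂ) : (yRoot i t)⁻¹ = yRoot i (-t) := by
  refine inv_eq_of_mul_eq_one_right ?_
  have hne := castSucc_ne_succ' i
  ext a b
  rw [yRoot_mul_apply]
  have key : ∀ a b, yRoot i (-t) a b = (1 : G r) a b +
      if a = i.succ then (-t) * (1 : G r) i.castSucc b else 0 := by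
    intro a b
    rw [← yRoot_mul_apply, mul_one]
  simp only [key, hne, if_false]
  split_ifs <;> ring

theorem xRoot_apply (i : Fin r) (t : ℂ) (a b : Fin (r + 1)) :
    xRoot i t a b = (if a = b then 1 else 0) + if a = i.castSucc ∧ b = i.succ then t else 0 := by
  have := xRoot_mul_apply i t 1 a b
  rw [mul_one] at this
  rw [this, Matrix.SpecialLinearGroup.coe_one, Matrix.one_apply, Matrix.one_apply]
  congr 1
  by_cases h1 : a = i.castSucc <;> by_cases h2 : b = i.succ <;> simp [h1, h2, eq_comm]

theorem yRoot_apply (i : Fin r) (t : ℂ) (a b : Fin (r + 1)) :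
    yRoot i t a b = (if a = b then 1 else 0) + if a = i.succ ∧ b = i.castSucc then t else 0 := by
  have := yRoot_mul_apply i t 1 a b
  rw [mul_one] at this
  rw [this, Matrix.SpecialLinearGroup.coe_one, Matrix.one_apply, Matrix.one_apply]
  congr 1
  by_cases h1 : a = i.succ <;> by_cases h2 : b = i.castSucc <;> simp [h1, h2, eq_comm]

theorem signConj_xRoot (i : Fin r) (t : ℂ) : signConj (xRoot i t) = xRoot i (-t) := by
  ext a b
  rw [signConj_apply, xRoot_apply, xRoot_apply]
  have hp : ∀ k : ℕ, ((-1 : ℂ) ^ k) * (-1) ^ k = 1 := fun k => by rw [← mul_pow]; norm_num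
  by_cases h : a = i.castSucc ∧ b = i.succ
  · obtain ⟨rfl, rfl⟩ := h
    simp only [castSucc_ne_succ', if_false, and_self, if_true, zero_add, Fin.val_castSucc, Fin.val_succ,
      pow_succ]
    linear_combination (-t) * hp i
  · rw [if_neg h, if_neg h]
    by_cases hab : a = b
    · subst hab
      simp only [if_true, add_zero, mul_one, hp]
    · simp [hab]

theorem signConj_yRoot (i : Fin r) (t : ℂ) : signConj (yRoot i t) = yRoot i (-t) := by
  ext a b
  rw [signConj_apply, yRoot_apply, yRoot_apply]
  have hp : ∀ k : ℕ, ((-1 : ℂ) ^ k) * (-1) ^ k = 1 := fun k => by rw [← mul_pow]; norm_num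
  by_cases h : a = i.succ ∧ b = i.castSucc
  · obtain ⟨rfl, rfl⟩ := h
    simp only [(castSucc_ne_succ' _).symm, if_false, and_self, if_true, zero_add, Fin.val_castSucc,
      Fin.val_succ, pow_succ]
    linear_combination (-t) * hp i
  · rw [if_neg h, if_neg h]
    by_cases hab : a = b
    · subst hab
      simp only [if_true, add_zero, mul_one, hp]
    · simp [hab]

theorem iota_xRoot (i : Fin r) (t : ℂ) : iota (xRoot i t) = xRoot i t := by
  rw [iota, xRoot_inv, signConj_xRoot, neg_neg]

theorem iota_yRoot (i : Fin r) (t : ℂ) : iota (yRoot i t) = yRoot i t := by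
  rw [iota, yRoot_inv, signConj_yRoot, neg_neg]

theorem theta_xRoot (i : Fin r) (t : ℂ) : theta (xRoot i t) = yRoot i t := by
  have : (xRoot i (-t)).transpose = yRoot i (-t) := by
    ext a b
    change xRoot i (-t) b a = _
    rw [xRoot_apply, yRoot_apply]
    simp only [eq_comm, and_comm]
  rw [theta, xRoot_inv, this, signConj_yRoot, neg_neg]

theorem theta_yRoot (i : Fin r) (t : ℂ) : theta (yRoot i t) = xRoot i t := by
  have : (yRoot i (-t)).transpose = xRoot i (-t) := by
    ext a b
    change yRoot i (-t) b a = _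
    rw [xRoot_apply, yRoot_apply]
    simp only [eq_comm, and_comm]
  rw [theta, yRoot_inv, this, signConj_xRoot, neg_neg]

theorem signConj_torus {h : G r} (hh : h ∈ torus r) : signConj h = h := by
  ext a b
  rw [signConj_apply]
  by_cases hab : a = b
  · subst hab
    rw [mul_right_comm, ← mul_pow]
    norm_num
  · rw [hh a b hab]; ring

theorem torus_inv {h : G r} (hh : h ∈ torus r) : h⁻¹ ∈ torus r := by
  intro a b hab
  have h1 : (h * h⁻¹) a b = h a a * h⁻¹ a b := by
    rw [Matrix.SpecialLinearGroup.coe_mul, Matrix.mul_apply, Finset.sum_eq_single a]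
    · intro k _ hk
      rw [hh a k (Ne.symm hk), zero_mul]
    · simp
  have h2 : (h * h⁻¹) a a = h a a * h⁻¹ a a := by
    rw [Matrix.SpecialLinearGroup.coe_mul, Matrix.mul_apply, Finset.sum_eq_single a]
    · intro k _ hk
      rw [hh a k (Ne.symm hk), zero_mul]
    · simp
  rw [mul_inv_cancel, Matrix.SpecialLinearGroup.coe_one, Matrix.one_apply] at h1 h2
  rw [if_neg hab] at h1
  rw [if_pos rfl] at h2
  rcases mul_eq_zero.1 h1.symm with h0 | h0
  · rw [h0, zero_mul] at h2
    exact absurd h2 one_ne_zero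
  · exact h0

theorem iota_torus {h : G r} (hh : h ∈ torus r) : iota h = h⁻¹ :=
  signConj_torus (torus_inv hh)

theorem theta_torus {h : G r} (hh : h ∈ torus r) : theta h = h⁻¹ := by
  have ht : (h⁻¹).transpose = h⁻¹ := by
    ext a b
    change h⁻¹ b a = h⁻¹ a b
    by_cases hab : a = b
    · rw [hab]
    · rw [torus_inv hh a b hab, torus_inv hh b a (Ne.symm hab)]
  rw [theta, ht, signConj_torus (torus_inv hh)]

/-- On `N⁻ H N` the principal minor is the fundamental weight of the `H`-component. -/
theorem principalMinor_gauss (i : Fin r) {a h b : G r} (ha : a ∈ lowerN r) (hh : h ∈ torus r)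
    (hb : b ∈ upperN r) :
    principalMinor i (a * h * b) =
      ∏ k : Fin ((i : ℕ) + 1), h (Fin.castLE (by omega) k) (Fin.castLE (by omega) k) := by
  have hle : (i : ℕ) + 1 ≤ r + 1 := by omega
  set f : Fin ((i : ℕ) + 1) → Fin (r + 1) := Fin.castLE hle with hf
  have hinj : Function.Injective f := Fin.castLE_injective hle
  have hout : ∀ (p : Fin ((i : ℕ) + 1)) (k : Fin (r + 1)), k ∉ Set.range f → f p < k := by
    intro p k hk
    by_contra hlt
    exact hk ⟨⟨k, lt_of_le_of_lt (Fin.le_def.1 (not_lt.1 hlt)) p.2⟩, rfl⟩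
  have hah : ∀ p q, (a * h) p q = a p q * h q q := mul_torus_apply hh
  have hsub : (a * h * b).1.submatrix f f =
      (a.1.submatrix f f * Matrix.diagonal fun k => h (f k) (f k)) * b.1.submatrix f f := by
    ext p q
    rw [Matrix.submatrix_apply, Matrix.mul_apply]
    change ((a * h).1 * b.1) (f p) (f q) = _
    rw [Matrix.mul_apply]
    symm
    refine Fintype.sum_of_injective f hinj _ _ (fun k hk => ?_) (fun k => ?_)
    · change (a * h) (f p) k * _ = 0
      rw [hah, ha.1 _ _ (hout p k hk), zero_mul, zero_mul]
    · rw [Matrix.mul_diagonal]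
      rw [hah]
      rfl
  have hlow : (a.1.submatrix f f).det = 1 := by
    rw [Matrix.det_of_isLowerTriangular]
    · exact Finset.prod_eq_one fun k _ => ha.2 _
    · intro p q hpq
      exact ha.1 _ _ hpq
  have hup : (b.1.submatrix f f).det = 1 := by
    rw [Matrix.det_of_isUpperTriangular]
    · exact Finset.prod_eq_one fun k _ => hb.2 _
    · intro p q hpq
      exact hb.1 _ _ hpq
  change ((a * h * b).1.submatrix f f).det = _
  rw [hsub, Matrix.det_mul, Matrix.det_mul, hlow, hup, Matrix.det_diagonal, one_mul, mul_one]

theorem succIdx_le (word : List (Fin r)) (k : SeedIndex word) :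
    succIdx word k ≤ (word.length : ℤ) + 1 :=
  Finset.min'_le _ _ (Finset.mem_insert_self _ _)

theorem succIdx_le_num (word : List (Fin r)) {k l : SeedIndex word} (h : num word k < num word l)
    (hl : letter word l = letter word k) : succIdx word k ≤ num word l :=
  Finset.min'_le _ _ (Finset.mem_insert_of_mem (Finset.mem_image.2 ⟨l, by simp [h, hl], rfl⟩))

theorem num_le (word : List (Fin r)) (k : SeedIndex word) : num word k ≤ word.length := by
  rcases k with i | k <;> simp only [num] <;> omega

theorem succIdx_spec (word : List (Fin r)) (k : SeedIndex word) :
    succIdx word k = (word.length : ℤ) + 1 ∨ ∃ l, num word k < num word l ∧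
      letter word l = letter word k ∧ succIdx word k = num word l := by
  have h := Finset.min'_mem (insert ((word.length : ℤ) + 1)
    ((Finset.univ.filter fun l => num word k < num word l ∧ letter word l = letter word k).image
      (num word))) (Finset.insert_nonempty _ _)
  rcases Finset.mem_insert.1 h with h | h
  · exact Or.inl h
  · obtain ⟨l, hl, he⟩ := Finset.mem_image.1 h
    simp only [Finset.mem_filter, Finset.mem_univ, true_and] at hl
    exact Or.inr ⟨l, hl.1, hl.2, he.symm⟩

theorem num_injective (word : List (Fin r)) : Function.Injective (num word) := by
  rintro (i | k) (j | l) h <;> simp only [num] at h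
  · congr 1; ext; omega
  · omega
  · omega
  · congr 1; ext; omega

theorem lt_succIdx (word : List (Fin r)) (k : SeedIndex word) : num word k < succIdx word k := by
  rcases succIdx_spec word k with h | ⟨l, h1, _, h3⟩
  · have := num_le word k; omega
  · omega

theorem succIdx_pos (word : List (Fin r)) (k : SeedIndex word) : 0 < succIdx word k := by
  rcases succIdx_spec word k with h | ⟨l, h1, h2, h3⟩
  · omega
  · rw [h3]
    rcases k with i | k <;> rcases l with j | l <;> simp only [num, letter] at h1 h2 ⊢
    · subst h2; omega
    all_goals omega

theorem num_ne_zero (word : List (Fin r)) (k : SeedIndex word) : num word k ≠ 0 := by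
  rcases k with i | k <;> simp only [num] <;> omega

theorem bracket_mul (P Q : Prop) [Decidable P] [Decidable Q] :
    bracket P * bracket Q = bracket (P ∧ Q) := by
  unfold bracket
  by_cases hP : P <;> by_cases hQ : Q <;> simp [hP, hQ]

theorem bracket_cases (P : Prop) [Decidable P] :
    ∃ e : ℤ, bracket P = e ∧ (P ∧ e = 1 ∨ ¬P ∧ e = 0) := by
  unfold bracket
  by_cases hP : P
  · exact ⟨1, by simp [hP], Or.inl ⟨hP, rfl⟩⟩
  · exact ⟨0, by simp [hP], Or.inr ⟨hP, rfl⟩⟩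

/-- The matrix `B + M` has integer entries. -/
theorem extendedMatrix_eq_floor (word : List (Fin r)) (j k : SeedIndex word) :
    ((⌊extendedMatrix word j k⌋ : ℤ) : ℚ) = extendedMatrix word j k := by
  suffices h : ∃ z : ℤ, extendedMatrix word j k = z by
    obtain ⟨z, hz⟩ := h
    rw [hz, Int.floor_intCast]
  simp only [extendedMatrix, exchangeMatrix, frozenMatrix, bracket_mul]
  obtain ⟨e1, w1, c1⟩ := bracket_cases (num word j = succIdx word k)
  obtain ⟨e2, w2, c2⟩ := bracket_cases (succIdx word j = num word k)
  obtain ⟨e3, w3, c3⟩ := bracket_cases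
    ((num word k < num word j ∧ num word j < succIdx word k) ∧ 0 < num word j)
  obtain ⟨e4, w4, c4⟩ := bracket_cases
    ((num word k < succIdx word j ∧ succIdx word j < succIdx word k) ∧
      succIdx word j ≤ (word.length : ℤ))
  obtain ⟨e5, w5, c5⟩ := bracket_cases
    ((num word j < num word k ∧ num word k < succIdx word j) ∧ 0 < num word k)
  obtain ⟨e6, w6, c6⟩ := bracket_cases
    ((num word j < succIdx word k ∧ succIdx word k < succIdx word j) ∧
      succIdx word k ≤ (word.length : ℤ))
  obtain ⟨e7, w7, c7⟩ := bracket_cases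
    ((word.length : ℤ) < succIdx word j ∧ (word.length : ℤ) < succIdx word k)
  obtain ⟨e8, w8, c8⟩ := bracket_cases (num word j < 0 ∧ num word k < 0)
  rw [w1, w2, w3, w4, w5, w6, w7, w8, ← mul_add]
  by_cases hl : letter word j = letter word k
  · have ha : CartanMatrix.A r (letter word k) (letter word j) = 2 := by
      rw [hl]; simp [CartanMatrix.A]
    exact ⟨-e1 + e2 - e3 + e4 + e5 - e6 + (e7 + e8), by rw [ha]; push_cast; ring⟩
  · have hjk : num word j ≠ num word k := fun h => hl (congrArg _ (num_injective word h))
    have h1 : num word j ≠ succIdx word k := by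
      intro h
      rcases succIdx_spec word k with h' | ⟨l, _, h2, h3⟩
      · have := num_le word j; omega
      · exact hl ((num_injective word (h.trans h3)) ▸ h2)
    have h2 : num word k ≠ succIdx word j := by
      intro h
      rcases succIdx_spec word j with h' | ⟨l, _, h2, h3⟩
      · have := num_le word k; omega
      · exact hl (((num_injective word (h.trans h3)) ▸ h2).symm)
    have h3 : succIdx word j = succIdx word k → succIdx word j = (word.length : ℤ) + 1 := by
      intro h
      rcases succIdx_spec word j with h' | ⟨l, _, h2, h3⟩
      · exact h'
      · rcases succIdx_spec word k with h' | ⟨l', _, h2', h3'⟩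
        · omega
        · have := num_injective word (h3.symm.trans (h.trans h3'))
          subst this
          exact absurd (h2.symm.trans h2') hl
    have b1 := succIdx_le word j
    have b2 := succIdx_le word k
    have b3 := lt_succIdx word j
    have b4 := lt_succIdx word k
    have b5 := succIdx_pos word j
    have b6 := succIdx_pos word k
    have b7 := num_ne_zero word j
    have b8 := num_ne_zero word k
    clear w1 w2 w3 w4 w5 w6 w7 w8
    have hz : ∃ z : ℤ, -e1 + e2 - e3 + e4 + e5 - e6 + (e7 + e8) = 2 * z := by
      generalize num word j = p at *
      generalize num word k = q at *
      generalize succIdx word j = p' at *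
      generalize succIdx word k = q' at *
      generalize (word.length : ℤ) = n at *
      have d1 : e1 = 0 := by omega
      have d2 : e2 = 0 := by omega
      subst d1 d2
      clear c1 c2
      suffices h : (-0 + 0 - e3 + e4 + e5 - e6 + (e7 + e8)) % 2 = 0 from
        ⟨_, (Int.mul_ediv_cancel' (Int.dvd_of_emod_eq_zero h)).symm⟩
      rcases lt_or_gt_of_ne hjk with hpq | hpq
      · have d3 : e3 = 0 := by omega
        rcases lt_or_gt_of_ne h2 with hq | hq
        · have d5 : e5 + e8 = 1 := by omega
          have d4 : e4 + e6 + e7 = 1 := by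
            rcases lt_trichotomy p' q' with h | h | h <;> omega
          omega
        · omega
      · have d5 : e5 = 0 := by omega
        rcases lt_or_gt_of_ne h1 with hq | hq
        · have d5 : e3 + e8 = 1 := by omega
          have d4 : e4 + e6 + e7 = 1 := by
            rcases lt_trichotomy p' q' with h | h | h <;> omega
          omega
        · omega
    obtain ⟨z, hz⟩ := hz
    refine ⟨CartanMatrix.A r (letter word k) (letter word j) * z, ?_⟩
    have hz' : ((-e1 + e2 - e3 + e4 + e5 - e6 + (e7 + e8) : ℤ) : ℚ) = ((2 * z : ℤ) : ℚ) := by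
      rw [hz]
    push_cast at hz' ⊢
    rw [hz']
    ring

/-- The length of `longWord r` is `r (r + 1) / 2`. -/
theorem longWord_length (r : ℕ) : (longWord r).length = ∑ l ∈ Finset.range r, (r - l) := by
  rw [longWord, List.length_flatMap, Finset.sum_range]
  simp [Fin.sum_univ_def]

/-- The `d`-th letter of the `m`-th cycle is at the place `place r m d`, and it is `d`. -/
theorem longWord_place (r m d : ℕ) (hm : 1 ≤ m) (hd : 1 ≤ d) (hmd : m + d ≤ r + 1) :
    (longWord r)[place r m d]? = some ⟨d - 1, by omega⟩ := by
  have gen : ∀ (L : List (List (Fin r))) (k e : ℕ) (hk : k < L.length) (_ : e < L[k].length),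
      L.flatten[((L.take k).map List.length).sum + e]? = L[k][e]? := by
    intro L
    induction L with
    | nil => intro k e hk; simp at hk
    | cons a L ih =>
      intro k e hk he
      cases k with
      | zero =>
        simp only [List.getElem_cons_zero] at he ⊢
        simp [List.getElem?_append_left, he]
      | succ k =>
        simp only [List.getElem_cons_succ] at he ⊢
        rw [← ih k e (by simpa using hk) he]
        rw [List.flatten_cons, List.take_succ_cons, List.map_cons, List.sum_cons,
          List.getElem?_append_right (by omega)]
        congr 1
        omega
  have hlen : (((List.finRange r).map fun l : Fin r =>
      (List.finRange (r - (l : ℕ))).map (Fin.castLE (by omega : r - (l : ℕ) ≤ r))).take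
        (m - 1)).map List.length = (List.range (m - 1)).map fun l => r - l := by
    apply List.ext_getElem
    · simp; omega
    · intro i h1 h2
      simp
  have := gen ((List.finRange r).map fun l : Fin r =>
    (List.finRange (r - (l : ℕ))).map (Fin.castLE (by omega : r - (l : ℕ) ≤ r))) (m - 1) (d - 1)
    (by simp; omega) (by simp; omega)
  rw [hlen] at this
  have hs : ((List.range (m - 1)).map fun l => r - l).sum = ∑ l ∈ Finset.range (m - 1), (r - l) := by
    rw [Finset.sum_range, Fin.sum_univ_def, ← List.map_coe_finRange_eq_range, List.map_map]
    rfl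
  rw [longWord, List.flatMap, place, ← hs]
  refine this.trans ?_
  rw [List.getElem?_eq_getElem (by simp; omega)]
  simp

end GeoCrystal

/-!
The twist turns the crystal action into an elementary column operation. Since `ι ∘ θ` is the
transposition, `z = ι (ζ x)` is the lower triangular matrix with `w₀⁻¹ x ∈ N⁻ zᵀ` (`mem_twist_iff`).
Multiplying `z` by `x_j(s)` on the left and by some `x_j(t)` on the right multiplies `zᵀ` by `y_j(s)` on
the right and by an element of `N⁻` on the left, so that `x` becomes `x y_j(s)` (`twist_mul_yRoot`).
Here `s = (c - 1) φ_j(z)`, and `χ_j(z) = 1 / φ_j(z)` is the quotient of the minors of `x` in the last `j`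
rows and the columns `1, …, j - 1, j + 1` and `1, …, j` (`chi_twist`).

The cluster coordinate `A_{m,d}` is the minor of `x` with the rows `m + 1, …, m + d` and the columns
`1, …, d` (`clusterMinor_seedIndex`); with `A_{0,d}` for the coordinate of the index `-d`, these are all
the coordinates. Right multiplication by `y_j(s)` adds `s` times the column `j + 1` to the column `j`. It
thus fixes `A_{m,d}` for `d ≠ j`, and it multiplies `A_{m,j}` by `1 + s Q_m`, where `Q_m` is the quotient
of the minors with the rows `m + 1, …, m + j` and the columns `1, …, j - 1, j + 1` and `1, …, j`. In
particular `s = (c - 1) / Q_{r+1-j}`. By the Desnanot–Jacobi identity (`det_mul_det_interior`),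
`Q_s - Q_{s-1}` is the monomial `q_s = A_{s-1,j+1} A_{s,j-1} / (A_{s,j} A_{s-1,j})`, and `Q_0 = 0` since
`x` is lower triangular. Hence `Q_m = q_1 + ⋯ + q_m` (`skipMinor_div_solidMinor`), and the factor of
`A_{m,j}` is `(c ∑_{s ≤ m} q_s + ∑_{s > m} q_s) / ∑ q_s`. The row of the matrix `B + M` at the place `(l, d)`
has at most six nonzero entries (`extendedMatrix_seedIndex`), and it gives `P_{l,d} = q_l / q_{l+1}`
(`coord_ensembleMap`), so that `P_{s,d} ⋯ P_{r-d,d}` is `q_s` up to a common factor.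

A lower triangular matrix is determined by its minors `A_{m,d}`, which can be any nonzero numbers, and
it belongs to the cell by the Gauss decomposition of `w₀⁻¹ x`; so the chart is defined everywhere
(`existsUnique_mem_chartInv`). The composition is therefore defined exactly where the sums above do not
vanish (`mem_twistedAction_iff`), and each of them is a nonzero rational function
(`weightedPoly_ne_zero`).
-/

namespace GeoCrystal

variable {r : ℕ}

/-! ### Solid minors in the leftmost columns -/

/-- The minor of the array `X` with the rows `m, …, m + d - 1` and the columns `0, …, d - 1`. Arrays
are indexed by all of `ℕ × ℕ`, so that no range conditions are needed. -/
def solidMinor (X : ℕ → ℕ → ℂ) (m d : ℕ) : ℂ :=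
  (Matrix.of fun i k : Fin d => X (m + i) k).det

/-- The minor of the array `X` with the rows `m, …, m + d` and the columns `0, …, d - 1, d + 1`. -/
def skipMinor (X : ℕ → ℕ → ℂ) (m d : ℕ) : ℂ :=
  (Matrix.of fun i k : Fin (d + 1) => X (m + i) (if (k : ℕ) < d then k else d + 1)).det

theorem solidMinor_zero (X : ℕ → ℕ → ℂ) (m : ℕ) : solidMinor X m 0 = 1 := Matrix.det_fin_zero

/-- The **Desnanot–Jacobi identity** for an invertible matrix `M`. It compares determinants in
`M * N = M'`, where the last two columns of `N` are the first and the last column of the adjugate of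
`M`, and the other columns of `N` are those of the identity matrix. -/
theorem det_mul_det_interior {n : ℕ} (M : Matrix (Fin (n + 2)) (Fin (n + 2)) ℂ) (hM : M.det ≠ 0) :
    M.det * (M.submatrix (fun i : Fin n => i.castSucc.succ) fun i => i.castSucc.castSucc).det =
      (M.submatrix Fin.succ (Fin.last n).castSucc.succAbove).det *
          (M.submatrix Fin.castSucc Fin.castSucc).det -
        (M.submatrix Fin.castSucc (Fin.last n).castSucc.succAbove).det *
          (M.submatrix Fin.succ Fin.castSucc).det := by
  set N : Matrix (Fin (n + 2)) (Fin (n + 2)) ℂ := Matrix.of fun i k =>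
    if (k : ℕ) < n then (if i = k then 1 else 0)
      else if (k : ℕ) = n then M.adjugate i 0 else M.adjugate i (Fin.last _) with hN
  have hdetN : N.det = M.adjugate (Fin.last n).castSucc 0 * M.adjugate (Fin.last _) (Fin.last _) -
      M.adjugate (Fin.last n).castSucc (Fin.last _) * M.adjugate (Fin.last _) 0 := by
    have hblock : N.submatrix (finSumFinEquiv (m := n) (n := 2)) finSumFinEquiv =
        Matrix.fromBlocks 1 (Matrix.of fun i k => N (Fin.castAdd 2 i) (Fin.natAdd n k)) 0
          (Matrix.of fun i k => N (Fin.natAdd n i) (Fin.natAdd n k)) := by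
      ext i k
      rcases i with i | i <;> rcases k with k | k
      · simp [hN, Matrix.one_apply]
      · simp
      · have : (Fin.natAdd n i : Fin (n + 2)) ≠ Fin.castAdd 2 k := by
          intro h
          have := congrArg Fin.val h
          simp at this
          omega
        simp [hN, this]
      · simp
    rw [← Matrix.det_submatrix_equiv_self (finSumFinEquiv (m := n) (n := 2)) N, hblock,
      Matrix.det_fromBlocks_zero₂₁, Matrix.det_one, one_mul, Matrix.det_fin_two]
    have h0 : (Fin.natAdd n (0 : Fin 2) : Fin (n + 2)) = (Fin.last n).castSucc := by ext; simp
    have h1 : (Fin.natAdd n (1 : Fin 2) : Fin (n + 2)) = Fin.last _ := by ext; simp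
    simp only [Matrix.of_apply, h0, h1, hN]
    simp
  have hMadj : ∀ i k, ∑ l, M i l * M.adjugate l k = if i = k then M.det else 0 := by
    intro i k
    have := congrFun (congrFun (Matrix.mul_adjugate M) i) k
    rw [Matrix.mul_apply] at this
    rw [this]
    simp [Matrix.one_apply]
  have hMN : ∀ i k, (M * N) i k = if (k : ℕ) < n then M i k
      else if (k : ℕ) = n then (if i = 0 then M.det else 0)
      else if i = Fin.last _ then M.det else 0 := by
    intro i k
    rw [Matrix.mul_apply]
    by_cases h1 : (k : ℕ) < n
    · simp [hN, h1]
    · by_cases h2 : (k : ℕ) = n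
      · simp only [hN, Matrix.of_apply, h2, lt_irrefl, if_false, if_true, hMadj]
      · simp only [hN, Matrix.of_apply, h1, h2, if_false, hMadj]
  have hdetMN : (M * N).det = M.det * ((-1) ^ n * (M.det *
      (M.submatrix (fun i : Fin n => i.castSucc.succ) fun i => i.castSucc.castSucc).det)) := by
    rw [Matrix.det_succ_column _ (Fin.last _), Finset.sum_eq_single (Fin.last _)]
    · rw [Matrix.det_succ_column _ (Fin.last _), Finset.sum_eq_single 0]
      · simp only [Fin.succAbove_last, Matrix.submatrix_apply, hMN, Matrix.submatrix_submatrix]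
        have : ((-1 : ℂ)) ^ (n + 1 + (n + 1)) = 1 := by rw [← two_mul]; simp
        have hs : ((M * N).submatrix (fun i : Fin n => i.castSucc.succ)
            fun i : Fin n => i.castSucc.castSucc) =
            M.submatrix (fun i : Fin n => i.castSucc.succ) fun i : Fin n => i.castSucc.castSucc := by
          ext i k
          simp [hMN]
        simp [this, Function.comp_def, hs, mul_assoc]
      · intro b _ hb
        have hb' : b.castSucc ≠ 0 := fun h => hb (Fin.ext (by simpa using congrArg Fin.val h))
        simp [hMN, hb']
      · simp
    · intro b _ hb
      simp [hMN, hb]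
    · simp
  rw [Matrix.det_mul, hdetN] at hdetMN
  simp only [Matrix.adjugate_fin_succ_eq_det_submatrix, Fin.succAbove_last, Fin.succAbove_zero] at hdetMN
  have hsq : ((-1 : ℂ)) ^ n * (-1) ^ n = 1 := by rw [← mul_pow]; simp
  have h3 := mul_left_cancel₀ hM hdetMN
  have e1 : ((-1 : ℂ)) ^ (n + 1 + (n + 1)) = 1 := by rw [← two_mul]; simp
  have e2 : ((-1 : ℂ)) ^ (n + 1 + n) = -1 := by rw [add_right_comm, ← two_mul, pow_succ]; simp
  have e3 : ((-1 : ℂ)) ^ (n + 1) = -(-1) ^ n := by ring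
  simp only [Fin.val_last, Fin.val_zero, Fin.val_castSucc, zero_add, e1, e2, e3] at h3
  generalize (M.submatrix (fun i : Fin n => i.castSucc.succ) fun i => i.castSucc.castSucc).det = a at *
  generalize (M.submatrix Fin.succ (Fin.last n).castSucc.succAbove).det = b at *
  generalize (M.submatrix Fin.castSucc Fin.castSucc).det = e at *
  generalize (M.submatrix Fin.castSucc (Fin.last n).castSucc.succAbove).det = f at *
  generalize (M.submatrix Fin.succ Fin.castSucc).det = g at *
  generalize ((-1 : ℂ)) ^ n = s at *
  linear_combination (-s) * h3 + (b * e - f * g - M.det * a) * hsq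

theorem solidMinor_mul_solidMinor (X : ℕ → ℕ → ℂ) (m n : ℕ) (h : solidMinor X m (n + 2) ≠ 0) :
    solidMinor X m (n + 2) * solidMinor X (m + 1) n =
      skipMinor X (m + 1) n * solidMinor X m (n + 1) -
        skipMinor X m n * solidMinor X (m + 1) (n + 1) := by
  have key := det_mul_det_interior _ h
  have hs : ∀ k : Fin (n + 1), (((Fin.last n).castSucc.succAbove k : Fin (n + 2)) : ℕ) =
      if (k : ℕ) < n then (k : ℕ) else n + 1 := by
    intro k
    by_cases hk : (k : ℕ) < n
    · rw [if_pos hk, Fin.succAbove_of_castSucc_lt _ _ (by simpa [Fin.lt_def] using hk)]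
      simp
    · rw [if_neg hk, Fin.succAbove_of_le_castSucc _ _ (by simpa [Fin.le_def] using hk)]
      simp; omega
  have e : ∀ {l : ℕ} (i : Fin l), m + ((i : ℕ) + 1) = m + 1 + i := fun i => by ring
  simp only [solidMinor, skipMinor]
  simp only [Matrix.submatrix, Matrix.of_apply, hs, Fin.val_succ, Fin.val_castSucc, e] at key
  exact key

theorem solidMinor_congr {X Y : ℕ → ℕ → ℂ} {m d : ℕ}
    (h : ∀ i k, k < d → X (m + i) k = Y (m + i) k) : solidMinor X m d = solidMinor Y m d := by
  unfold solidMinor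
  congr 1
  ext i k
  exact h i k k.2

/-- Expansion of a solid minor along its last column. -/
theorem exists_solidMinor_succ (X : ℕ → ℕ → ℂ) (m d : ℕ) : ∃ w : Fin d → ℂ, ∀ Y : ℕ → ℕ → ℂ,
    (∀ a b, b < d → Y a b = X a b) → solidMinor Y m (d + 1) =
      solidMinor X m d * Y (m + d) d + ∑ i : Fin d, w i * Y (m + i) d := by
  refine ⟨fun i => (-1) ^ ((i : ℕ) + d) *
    (Matrix.of fun a k : Fin d => X (m + ((i.castSucc.succAbove a : Fin (d + 1)) : ℕ)) k).det,
    fun Y hY => ?_⟩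
  rw [solidMinor, Matrix.det_succ_column _ (Fin.last d), Fin.sum_univ_castSucc, add_comm]
  congr 1
  · have h1 : ((-1 : ℂ)) ^ (d + d) = 1 := by rw [← two_mul]; simp
    have h2 : ((Matrix.of fun i k : Fin (d + 1) => Y (m + i) k).submatrix
        (Fin.last d).succAbove (Fin.last d).succAbove) = Matrix.of fun i k : Fin d => X (m + i) k := by
      ext i k
      simp [hY]
    rw [h2]
    simp [h1, solidMinor, mul_comm]
  · refine Finset.sum_congr rfl fun i _ => ?_
    have h2 : ((Matrix.of fun i k : Fin (d + 1) => Y (m + i) k).submatrix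
        i.castSucc.succAbove (Fin.last d).succAbove) =
        Matrix.of fun a k : Fin d => X (m + ((i.castSucc.succAbove a : Fin (d + 1)) : ℕ)) k := by
      ext a k
      simp [hY]
    rw [h2]
    simp
    ring

/-- A column can be chosen so that the solid minors ending there take prescribed values. -/
theorem exists_column (X : ℕ → ℕ → ℂ) (d : ℕ) (f : ℕ → ℂ) (hX : ∀ m, solidMinor X m d ≠ 0) :
    ∃ v : ℕ → ℂ, (∀ a < d, v a = 0) ∧
      ∀ m, solidMinor (fun a b => if b = d then v a else X a b) m (d + 1) = f m := by
  choose w hw using fun m => exists_solidMinor_succ X m d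
  let step : (n : ℕ) → ((k : ℕ) → k < n → ℂ) → ℂ := fun n prev =>
    if h : n < d then 0 else
      (f (n - d) - ∑ i : Fin d, w (n - d) i * prev (n - d + i) (by omega)) / solidMinor X (n - d) d
  let v : ℕ → ℂ := fun n => Nat.strongRec (motive := fun _ => ℂ) step n
  have hv : ∀ n, v n = step n fun k _ => v k := fun n => Nat.strongRec_eq step n
  refine ⟨v, fun a ha => ?_, fun m => ?_⟩
  · rw [hv]; exact dif_pos ha
  · rw [hw m _ fun a b hb => if_neg hb.ne]
    have := hv (m + d)
    simp only [step, show ¬ (m + d < d) by omega, dite_false, Nat.add_sub_cancel] at this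
    simp only [if_true]
    rw [this]
    field_simp [hX m]
    ring

/-- There is a lower triangular array with prescribed nonzero solid minors. -/
theorem exists_array (f : ℕ → ℕ → ℂ) (hf : ∀ m d, f m d ≠ 0) (D : ℕ) :
    ∃ X : ℕ → ℕ → ℂ, (∀ a b, a < b → X a b = 0) ∧
      ∀ m d, 1 ≤ d → d ≤ D → solidMinor X m d = f m d := by
  induction D with
  | zero => exact ⟨fun _ _ => 0, fun _ _ _ => rfl, fun m d h1 h2 => by omega⟩
  | succ D ih =>
    obtain ⟨X, hX, hXf⟩ := ih
    obtain ⟨v, hv0, hv⟩ := exists_column X D (fun m => f m (D + 1)) fun m => by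
      rcases Nat.eq_zero_or_pos D with h | h
      · subst h; rw [solidMinor_zero]; exact one_ne_zero
      · rw [hXf m D h le_rfl]; exact hf _ _
    refine ⟨fun a b => if b = D then v a else X a b, fun a b hab => ?_, fun m d h1 h2 => ?_⟩
    · by_cases h : b = D
      · subst h; simpa using hv0 a hab
      · simpa [h] using hX a b hab
    · rcases Nat.lt_or_ge d (D + 1) with h | h
      · rw [← hXf m d h1 (by omega)]
        exact solidMinor_congr fun i k hk => if_neg (by omega)
      · obtain rfl : d = D + 1 := by omega
        exact hv m

/-- A lower triangular array is determined by its solid minors, as far as they do not vanish. -/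
theorem eq_of_solidMinor_eq {X Y : ℕ → ℕ → ℂ} {n : ℕ} (hX : ∀ a b, a < b → X a b = 0)
    (hY : ∀ a b, a < b → Y a b = 0)
    (h0 : ∀ m d, m + d ≤ n → solidMinor X m d ≠ 0)
    (h : ∀ m d, m + d ≤ n → solidMinor Y m d = solidMinor X m d) :
    ∀ b a, a < n → Y a b = X a b := by
  intro b
  induction b using Nat.strong_induction_on with
  | _ b ihb =>
    intro a
    induction a using Nat.strong_induction_on with
    | _ a iha =>
      intro ha
      rcases Nat.lt_or_ge a b with hab | hab
      · rw [hX a b hab, hY a b hab]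
      · obtain ⟨m, rfl⟩ := Nat.exists_eq_add_of_le' hab
        have hXm := h0 m b (by omega)
        -- Only the rows below `n` matter; elsewhere `Y` is replaced by `X`.
        set Z : ℕ → ℕ → ℂ := fun a b => if a < n then Y a b else X a b with hZ
        have e : ∀ d, m + d ≤ n → solidMinor Z m d = solidMinor Y m d := by
          intro d hd
          unfold solidMinor
          congr 1
          ext i k
          simp [hZ, show m + (i : ℕ) < n by omega]
        obtain ⟨w, hw⟩ := exists_solidMinor_succ X m b
        have h1 := hw X fun _ _ _ => rfl
        have h2 := hw Z fun a' b' hb' => by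
          by_cases h : a' < n
          · simp only [hZ, h, if_true]; exact ihb b' hb' a' h
          · simp [hZ, h]
        have h3 : ∀ i : Fin b, Z (m + i) b = X (m + i) b := by
          intro i
          simp only [hZ, show m + (i : ℕ) < n by omega, if_true]
          exact iha _ (by omega) (by omega)
        rw [e _ (by omega), h _ _ (by omega), h1] at h2
        simp only [h3] at h2
        have h4 := mul_left_cancel₀ hXm (add_right_cancel h2)
        rw [h4]
        simp [hZ, ha]

/-! ### A column operation -/

theorem solidMinor_add_col_of_ne (X : ℕ → ℕ → ℂ) (j : ℕ) (t : ℂ) (m d : ℕ) (hd : d ≠ j + 1) :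
    solidMinor (fun a b => X a b + if b = j then t * X a (j + 1) else 0) m d = solidMinor X m d := by
  rcases Nat.lt_or_ge d (j + 1) with h | h
  · exact solidMinor_congr fun i k hk => by simp [show k ≠ j by omega]
  · have hne : (⟨j, by omega⟩ : Fin d) ≠ ⟨j + 1, by omega⟩ := by simp [Fin.ext_iff]
    rw [solidMinor, solidMinor,
      ← Matrix.det_updateCol_add_smul_self (Matrix.of fun i k : Fin d => X (m + i) k) hne t]
    congr 1
    ext i k
    by_cases hk : (k : ℕ) = j
    · have : k = ⟨j, by omega⟩ := Fin.ext hk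
      simp [this]
    · have : k ≠ ⟨j, by omega⟩ := fun h => hk (congrArg Fin.val h)
      simp [hk, this]

theorem solidMinor_add_col (X : ℕ → ℕ → ℂ) (j : ℕ) (t : ℂ) (m : ℕ) :
    solidMinor (fun a b => X a b + if b = j then t * X a (j + 1) else 0) m (j + 1) =
      solidMinor X m (j + 1) + t * skipMinor X m j := by
  set M : Matrix (Fin (j + 1)) (Fin (j + 1)) ℂ := Matrix.of fun i k => X (m + i) k with hM
  have h1 : (Matrix.of fun i k : Fin (j + 1) =>
      X (m + i) k + if (k : ℕ) = j then t * X (m + i) (j + 1) else 0) =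
      M.updateCol (Fin.last j) 
        ((fun i : Fin (j + 1) => X (m + i) j) + t • fun i : Fin (j + 1) => X (m + i) (j + 1)) := by
    ext i k
    by_cases hk : (k : ℕ) = j
    · obtain rfl : k = Fin.last j := Fin.ext hk
      simp
    · have : k ≠ Fin.last j := fun h => hk (congrArg Fin.val h)
      simp [hk, this, hM]
  have h2 : M.updateCol (Fin.last j) (fun i => X (m + i) j) = M := by
    ext i k
    by_cases hk : k = Fin.last j
    · subst hk; simp [hM]
    · simp [hk]
  have h3 : M.updateCol (Fin.last j) (fun i => X (m + i) (j + 1)) =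
      Matrix.of fun i k : Fin (j + 1) => X (m + i) (if (k : ℕ) < j then k else j + 1) := by
    ext i k
    by_cases hk : k = Fin.last j
    · subst hk; simp
    · have : (k : ℕ) < j := by
        have := fun h => hk (Fin.ext h)
        simp at this; omega
      simp [hk, hM, this]
  rw [solidMinor, h1, Matrix.det_updateCol_add, Matrix.det_updateCol_smul, h2, h3]
  rfl

/-- By the three-term relation `solidMinor_mul_solidMinor`, the quotients of `skipMinor X s j` by
`solidMinor X s (j + 1)` for successive `s` differ by a monomial in the solid minors. The quotient for
`s = 0` vanishes, as `X` is lower triangular. -/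
theorem skipMinor_div_solidMinor {X : ℕ → ℕ → ℂ} (hX : ∀ a b, a < b → X a b = 0) (j M : ℕ)
    (h1 : ∀ m ≤ M, solidMinor X m (j + 1) ≠ 0) (h2 : ∀ m < M, solidMinor X m (j + 2) ≠ 0) :
    skipMinor X M j / solidMinor X M (j + 1) = ∑ s ∈ Finset.Icc 1 M,
      solidMinor X (s - 1) (j + 2) * solidMinor X s j /
        (solidMinor X s (j + 1) * solidMinor X (s - 1) (j + 1)) := by
  induction M with
  | zero =>
    have : skipMinor X 0 j = 0 := by
      apply Matrix.det_eq_zero_of_column_eq_zero (Fin.last j)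
      intro i
      simp only [Matrix.of_apply, Fin.val_last, lt_irrefl, if_false]
      exact hX _ _ (by omega)
    simp [this]
  | succ M ih =>
    rw [← Finset.insert_Icc_right_eq_Icc_add_one (by omega), Finset.sum_insert (by simp),
      ← ih (fun m hm => h1 m (by omega)) fun m hm => h2 m (by omega)]
    have h := solidMinor_mul_solidMinor X M j (h2 M (by omega))
    have ha := h1 M (by omega)
    have hb := h1 (M + 1) le_rfl
    rw [Nat.add_sub_cancel, h]
    field_simp
    ring

/-! ### The cluster coordinates as solid minors -/

/-- The entries of a matrix as an array, with rows and columns numbered from `0` and extended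
by `0`. -/
def entries (x : G r) (a b : ℕ) : ℂ :=
  if h : a < r + 1 ∧ b < r + 1 then x ⟨a, h.1⟩ ⟨b, h.2⟩ else 0

theorem entries_coe (x : G r) (a b : Fin (r + 1)) : entries x a b = x a b := dif_pos ⟨a.2, b.2⟩

theorem entries_of_lt (x : G r) {a b : ℕ} (ha : a < r + 1) (hb : b < r + 1) :
    entries x a b = x ⟨a, ha⟩ ⟨b, hb⟩ := dif_pos ⟨ha, hb⟩

theorem entries_eq_zero {x : G r} (hx : x ∈ lowerB r) (a b : ℕ) (hab : a < b) :
    entries x a b = 0 := by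
  unfold entries
  split_ifs with h
  · exact hx _ _ hab
  · rfl

theorem entries_injective : Function.Injective (entries (r := r)) := by
  intro x y h
  ext a b
  rw [← entries_coe, ← entries_coe, h]

theorem entries_mul_yRoot (x : G r) (j : Fin r) (t : ℂ) :
    entries (x * yRoot j t) =
      fun a b => entries x a b + if b = j then t * entries x a (j + 1) else 0 := by
  funext a b
  by_cases h : a < r + 1 ∧ b < r + 1
  · rw [entries_of_lt _ h.1 h.2, entries_of_lt _ h.1 h.2, mul_yRoot_apply,
      entries_of_lt _ h.1 (by omega)]
    simp only [Fin.ext_iff, Fin.val_castSucc]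
    rfl
  · simp only [entries, h, dite_false, zero_add]
    split_ifs with h1 h2
    · omega
    · simp
    · rfl

theorem solidMinor_entries_zero_succ (x : G r) : solidMinor (entries x) 0 (r + 1) = 1 := by
  rw [← x.2, solidMinor]
  congr 1
  ext i k
  simp only [Matrix.of_apply, zero_add]
  exact entries_coe x i k

theorem sBar_inv_mul_apply (i : Fin r) (g : G r) (a b : Fin (r + 1)) :
    ((sBar i)⁻¹ * g) a b = if a = i.castSucc then g i.succ b
      else if a = i.succ then -g i.castSucc b else g a b := by
  have h : ∀ a, g a b = (sBar i * ((sBar i)⁻¹ * g)) a b := fun a => by rw [mul_inv_cancel_left]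
  have hne := castSucc_ne_succ' i
  rw [h a, h i.succ, h i.castSucc]
  simp only [sBar_mul_apply]
  split_ifs <;> simp_all

theorem place_succ_succ (r m d : ℕ) :
    place r (m + 1) (d + 1) = (∑ l ∈ Finset.range m, (r - l)) + d := by
  simp [place]

theorem place_lt_length {m d : ℕ} (hm : 1 ≤ m) (hd : 1 ≤ d) (hmd : m + d ≤ r + 1) :
    place r m d < (longWord r).length := by
  have := longWord_place r m d hm hd hmd
  exact (List.getElem?_eq_some_iff.1 this).1

theorem get_place {m d : ℕ} (hm : 1 ≤ m) (hd : 1 ≤ d) (hmd : m + d ≤ r + 1)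
    (h : place r m d < (longWord r).length) :
    (longWord r)[place r m d] = ⟨d - 1, by omega⟩ := by
  have := longWord_place r m d hm hd hmd
  exact (List.getElem?_eq_some_iff.1 this).2

theorem inv_wordBar_take_mul_apply_step (x : G r) (m d : ℕ) (h : m + d < r)
    (ih : ∀ i b : Fin (r + 1),
      ((wordBar ((longWord r).take (place r (m + 1) (d + 1))))⁻¹ * x) i b =
        if (i : ℕ) < d then entries x (m + 1 + i) b
        else if (i : ℕ) = d then (-1) ^ d * entries x m b
        else if (i : ℕ) ≤ r - m then entries x (m + i) b
        else (-1) ^ (i : ℕ) * entries x (r - i) b) (i b : Fin (r + 1)) :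
    ((wordBar ((longWord r).take (place r (m + 1) (d + 1 + 1))))⁻¹ * x) i b =
      if (i : ℕ) < d + 1 then entries x (m + 1 + i) b
      else if (i : ℕ) = d + 1 then (-1) ^ (d + 1) * entries x m b
      else if (i : ℕ) ≤ r - m then entries x (m + i) b
      else (-1) ^ (i : ℕ) * entries x (r - i) b := by
  have hp : place r (m + 1) (d + 1 + 1) = place r (m + 1) (d + 1) + 1 := by
    rw [place_succ_succ, place_succ_succ, add_assoc]
  have hlt := place_lt_length (r := r) (m := m + 1) (d := d + 1) (by omega) (by omega) (by omega)
  rw [hp, wordBar, List.take_succ_eq_append_getElem hlt, get_place (by omega) (by omega) (by omega)]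
  simp only [List.map_append, List.prod_append, List.map_cons, List.map_nil, List.prod_cons,
    List.prod_nil, mul_one, mul_inv_rev, mul_assoc]
  rw [wordBar] at ih
  simp only [sBar_inv_mul_apply, ih, Fin.ext_iff, Fin.val_castSucc, Fin.val_succ,
    Nat.add_sub_cancel]
  rcases lt_trichotomy (i : ℕ) d with hi | hi | hi
  · simp [hi, hi.ne, show (i : ℕ) ≠ d + 1 by omega, show (i : ℕ) < d + 1 by omega]
  · simp only [hi, if_true, lt_irrefl, if_false, show ¬ (d + 1 < d) by omega,
      show ¬ (d + 1 = d) by omega, show d + 1 ≤ r - m by omega, show d < d + 1 by omega]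
    congr 1
    omega
  · by_cases hi' : (i : ℕ) = d + 1
    · simp [hi']
      ring
    · simp [show ¬ ((i : ℕ) < d) by omega, show ¬ ((i : ℕ) < d + 1) by omega, hi', hi.ne']

/-- The rows of `w⁻¹ x`, where `w` represents the prefix of `longWord r` that consists of `m` full
cycles and `d` further letters. -/
theorem inv_wordBar_take_mul_apply (x : G r) (m d : ℕ) (h : m + d ≤ r) (i b : Fin (r + 1)) :
    ((wordBar ((longWord r).take (place r (m + 1) (d + 1))))⁻¹ * x) i b =
      if (i : ℕ) < d then entries x (m + 1 + i) b
      else if (i : ℕ) = d then (-1) ^ d * entries x m b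
      else if (i : ℕ) ≤ r - m then entries x (m + i) b
      else (-1) ^ (i : ℕ) * entries x (r - i) b := by
  have hd : ∀ m, (∀ i b : Fin (r + 1),
      ((wordBar ((longWord r).take (place r (m + 1) (0 + 1))))⁻¹ * x) i b =
        if (i : ℕ) < 0 then entries x (m + 1 + i) b
        else if (i : ℕ) = 0 then (-1) ^ 0 * entries x m b
        else if (i : ℕ) ≤ r - m then entries x (m + i) b
        else (-1) ^ (i : ℕ) * entries x (r - i) b) → ∀ d, m + d ≤ r → ∀ i b : Fin (r + 1),
      ((wordBar ((longWord r).take (place r (m + 1) (d + 1))))⁻¹ * x) i b =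
        if (i : ℕ) < d then entries x (m + 1 + i) b
        else if (i : ℕ) = d then (-1) ^ d * entries x m b
        else if (i : ℕ) ≤ r - m then entries x (m + i) b
        else (-1) ^ (i : ℕ) * entries x (r - i) b := by
    intro m h0 d
    induction d with
    | zero => exact fun _ => h0
    | succ d ih => exact fun h => inv_wordBar_take_mul_apply_step x m d h (ih (by omega))
  refine hd m ?_ d h i b
  have hm : m ≤ r := by omega
  clear h i b
  induction m with
  | zero =>
    intro i b
    have hi : (i : ℕ) ≤ r := by omega
    simp only [place, wordBar]
    by_cases h0 : (i : ℕ) = 0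
    · simp [h0, ← entries_coe]
    · simp [h0, hi, ← entries_coe]
  | succ m ihm =>
    intro i b
    have hp : place r (m + 1 + 1) (0 + 1) = place r (m + 1) (r - m + 1) := by
      rw [place_succ_succ, place_succ_succ, Finset.sum_range_succ, add_zero]
    rw [hp, hd m (ihm (by omega)) (r - m) (by omega)]
    -- After a full cycle, the row `x_m` has arrived at the place `r - m`.
    rcases lt_trichotomy (i : ℕ) (r - m) with hi | hi | hi
    · by_cases h0 : (i : ℕ) = 0
      · simp [h0, show m < r by omega]
      · simp [h0, hi, show (i : ℕ) ≤ r - (m + 1) by omega]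
    · simp [hi, show ¬ (r - m = 0) by omega, show ¬ (r - m ≤ r - (m + 1)) by omega,
        show r - (r - m) = m by omega]
    · simp [show ¬ ((i : ℕ) < r - m) by omega, hi.ne', hi.not_ge, show ¬ ((i : ℕ) = 0) by omega,
        show ¬ ((i : ℕ) ≤ r - (m + 1)) by omega]

/-- The representative of `w₀` is antidiagonal. -/
theorem inv_wordBar_longWord_mul_apply (x : G r) (i b : Fin (r + 1)) :
    ((wordBar (longWord r))⁻¹ * x) i b = (-1) ^ (i : ℕ) * entries x (r - i) b := by
  have h := inv_wordBar_take_mul_apply x r 0 le_rfl i b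
  rw [place_succ_succ, add_zero, ← longWord_length, List.take_length] at h
  rw [h]
  by_cases h0 : (i : ℕ) = 0
  · simp [h0]
  · simp [h0]

/-- The condition under which `seedIndex` is defined. -/
def IsSeedPlace (r m d : ℕ) : Prop := 1 ≤ d ∧ d ≤ r ∧ m + d ≤ r + 1

/-- The index of the `d`-th letter of the `m`-th cycle for `m ≥ 1`, and the index `-d` for `m = 0`. -/
def seedIndex (r m d : ℕ) (h : IsSeedPlace r m d) : SeedIndex (longWord r) :=
  if hm : m = 0 then Sum.inl ⟨d - 1, by have := h.1; have := h.2.1; omega⟩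
  else Sum.inr ⟨place r m d, place_lt_length (by omega) h.1 h.2.2⟩

theorem letter_seedIndex {m d : ℕ} (h : IsSeedPlace r m d) :
    (letter (longWord r) (seedIndex r m d h) : ℕ) = d - 1 := by
  unfold seedIndex
  split_ifs with hm
  · rfl
  · simp only [letter, List.get_eq_getElem]
    rw [get_place (by omega) h.1 h.2.2]

theorem exists_place {p : ℕ} : ∀ {M : ℕ}, M ≤ r → p < ∑ l ∈ Finset.range M, (r - l) →
    ∃ m d, 1 ≤ m ∧ m ≤ M ∧ 1 ≤ d ∧ m + d ≤ r + 1 ∧ p = place r m d := by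
  intro M
  induction M with
  | zero => intro _ h; simp at h
  | succ M ih =>
    intro hM h
    rw [Finset.sum_range_succ] at h
    rcases Nat.lt_or_ge p (∑ l ∈ Finset.range M, (r - l)) with h' | h'
    · obtain ⟨m, d, h1, h2, h3⟩ := ih (by omega) h'
      exact ⟨m, d, h1, by omega, h3⟩
    · refine ⟨M + 1, p - (∑ l ∈ Finset.range M, (r - l)) + 1, by omega, le_rfl, by omega, by omega, ?_⟩
      rw [place_succ_succ]
      omega

theorem exists_seedIndex (k : SeedIndex (longWord r)) : ∃ m d h, k = seedIndex r m d h := by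
  rcases k with i | ⟨p, hp⟩
  · exact ⟨0, i + 1, ⟨by omega, by omega, by omega⟩, by simp [seedIndex]⟩
  · have hp' := hp
    rw [longWord_length] at hp'
    obtain ⟨m, d, h1, h2, h3, h4, rfl⟩ := exists_place le_rfl hp'
    exact ⟨m, d, ⟨h3, by omega, h4⟩, by simp [seedIndex, show m ≠ 0 by omega]⟩

theorem clusterMinor_seedIndex (x : G r) {m d : ℕ} (h : IsSeedPlace r m d) :
    clusterMinor (longWord r) (seedIndex r m d h) x = solidMinor (entries x) m d := by
  have hpm : ∀ (i : Fin r) (g : G r), (i : ℕ) + 1 = d →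
      (∀ a b : Fin (r + 1), (a : ℕ) < d → g a b = entries x (m + a) b) →
      principalMinor i g = solidMinor (entries x) m d := by
    rintro i g rfl hg
    unfold principalMinor solidMinor
    congr 1
    ext a b
    exact hg _ _ a.2
  refine hpm _ _ (by have := letter_seedIndex h; have := h.1; omega) fun a b ha => ?_
  unfold seedIndex
  split_ifs with hm
  · subst hm
    simp [prefixBar, entries_coe]
  · obtain ⟨m, rfl⟩ := Nat.exists_eq_succ_of_ne_zero hm
    obtain ⟨d, rfl⟩ := Nat.exists_eq_add_of_le' h.1
    have h3 := h.2.2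
    have := inv_wordBar_take_mul_apply x m (d + 1) (by omega) a b
    rw [if_pos ha] at this
    have hp : place r (m + 1) (d + 1 + 1) = place r (m + 1) (d + 1) + 1 := by
      rw [place_succ_succ, place_succ_succ, add_assoc]
    rw [mul_one, ← this, hp]
    rfl

/-! ### Triangular matrices and the Gauss decomposition -/

theorem mem_lowerB_iff {x : G r} : x ∈ lowerB r ↔ x.1.IsLowerTriangular :=
  ⟨fun h _ _ hij => h _ _ hij, fun h _ _ hij => h hij⟩

theorem transpose_mem_upperB {x : G r} (hx : x ∈ lowerB r) : x.transpose ∈ upperB r :=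
  fun i j hij => hx j i hij

theorem transpose_mem_lowerB {x : G r} (hx : x ∈ upperB r) : x.transpose ∈ lowerB r :=
  fun i j hij => hx j i hij

theorem transpose_mul (x y : G r) : (x * y).transpose = y.transpose * x.transpose :=
  Subtype.ext (Matrix.transpose_mul _ _)

theorem transpose_one : (1 : G r).transpose = 1 := Subtype.ext Matrix.transpose_one

theorem transpose_transpose (x : G r) : x.transpose.transpose = x := rfl

theorem transpose_inv (x : G r) : (x⁻¹).transpose = (x.transpose)⁻¹ := by
  rw [eq_inv_iff_mul_eq_one, ← transpose_mul, mul_inv_cancel, transpose_one]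

theorem lowerB_mul {x y : G r} (hx : x ∈ lowerB r) (hy : y ∈ lowerB r) : x * y ∈ lowerB r :=
  mem_lowerB_iff.2 ((mem_lowerB_iff.1 hx).mul (mem_lowerB_iff.1 hy))

theorem lowerB_inv {x : G r} (hx : x ∈ lowerB r) : x⁻¹ ∈ lowerB r := by
  rw [mem_lowerB_iff] at hx ⊢
  have hdet : x.1.det = 1 := x.2
  have : Invertible x.1 := Matrix.invertibleOfIsUnitDet _ (by rw [hdet]; exact isUnit_one)
  have h := Matrix.blockTriangular_inv_of_blockTriangular hx
  rwa [Matrix.inv_def, hdet, Ring.inverse_one, one_smul, ← Matrix.SpecialLinearGroup.coe_inv] at h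

theorem upperB_mul {x y : G r} (hx : x ∈ upperB r) (hy : y ∈ upperB r) : x * y ∈ upperB r := by
  have := transpose_mem_upperB (lowerB_mul (transpose_mem_lowerB hy) (transpose_mem_lowerB hx))
  rwa [← transpose_mul] at this

theorem upperB_inv {x : G r} (hx : x ∈ upperB r) : x⁻¹ ∈ upperB r := by
  have := transpose_mem_upperB (lowerB_inv (transpose_mem_lowerB hx))
  rwa [← transpose_inv] at this

theorem mul_apply_diag {x y : G r} (hx : x ∈ lowerB r) (hy : y ∈ lowerB r) (a : Fin (r + 1)) :
    (x * y) a a = x a a * y a a := by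
  rw [Matrix.SpecialLinearGroup.coe_mul, Matrix.mul_apply]
  refine Finset.sum_eq_single a (fun b _ hb => ?_) (by simp)
  rcases lt_or_gt_of_ne hb with h | h
  · rw [hy _ _ h, mul_zero]
  · rw [hx _ _ h, zero_mul]

theorem diag_ne_zero {x : G r} (hx : x ∈ lowerB r) (a : Fin (r + 1)) : x a a ≠ 0 := by
  intro h
  have h1 := mul_apply_diag hx (lowerB_inv hx) a
  rw [mul_inv_cancel, h, zero_mul] at h1
  simp at h1

theorem lowerN_mul {x y : G r} (hx : x ∈ lowerN r) (hy : y ∈ lowerN r) : x * y ∈ lowerN r :=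
  ⟨lowerB_mul hx.1 hy.1, fun a => by rw [mul_apply_diag hx.1 hy.1, hx.2, hy.2, one_mul]⟩

theorem lowerN_inv {x : G r} (hx : x ∈ lowerN r) : x⁻¹ ∈ lowerN r :=
  ⟨lowerB_inv hx.1, fun a => by
    have h := mul_apply_diag hx.1 (lowerB_inv hx.1) a
    rw [mul_inv_cancel, hx.2, one_mul] at h
    rw [← h]
    simp⟩

theorem eq_one_of_mem_lowerN_of_mem_upperB {x : G r} (h1 : x ∈ lowerN r) (h2 : x ∈ upperB r) :
    x = 1 := by
  ext a b
  rcases lt_trichotomy a b with h | h | h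
  · rw [h1.1 _ _ h]; simp [h.ne]
  · subst h; rw [h1.2]; simp
  · rw [h2 _ _ h]; simp [h.ne']

theorem exists_lowerN_mul_torus {x : G r} (hx : x ∈ lowerB r) :
    ∃ n ∈ lowerN r, ∃ h ∈ torus r, x = n * h := by
  have hdet : (Matrix.diagonal fun a => x.1 a a).det = 1 := by
    rw [Matrix.det_diagonal, ← Matrix.det_of_isLowerTriangular _ (mem_lowerB_iff.1 hx), x.2]
  set h : G r := ⟨_, hdet⟩ with hh
  have ht : h ∈ torus r := fun i j hij => Matrix.diagonal_apply_ne _ hij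
  have hd : ∀ a, h a a = x a a := fun a => Matrix.diagonal_apply_eq _ _
  have hl : h ∈ lowerB r := fun i j hij => ht _ _ hij.ne
  refine ⟨x * h⁻¹, ⟨lowerB_mul hx (lowerB_inv hl), fun a => ?_⟩, h, ht, by group⟩
  rw [mul_apply_diag hx (lowerB_inv hl), ← hd, ← mul_apply_diag hl (lowerB_inv hl), mul_inv_cancel]
  simp

theorem lowerN_mul_upperB_mem_gaussSet {n y : G r} (hn : n ∈ lowerN r) (hy : y ∈ upperB r) :
    n * y ∈ gaussSet r := by
  obtain ⟨m, hm, h, hh, he⟩ := exists_lowerN_mul_torus (transpose_mem_lowerB hy)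
  refine ⟨n, hn, h.transpose, fun i j hij => hh _ _ hij.symm, m.transpose,
    ⟨fun i j hij => hm.1 _ _ hij, hm.2⟩, ?_⟩
  rw [mul_assoc, ← transpose_mul, ← he, transpose_transpose]

theorem eq_of_lowerN_mul_upperB_eq {n n' y y' : G r} (hn : n ∈ lowerN r) (hn' : n' ∈ lowerN r)
    (hy : y ∈ upperB r) (hy' : y' ∈ upperB r) (h : n * y = n' * y') : y = y' := by
  have h1 : n'⁻¹ * n = y' * y⁻¹ := by
    rw [eq_mul_inv_iff_mul_eq, mul_assoc, h, inv_mul_cancel_left]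
  have h2 := eq_one_of_mem_lowerN_of_mem_upperB (lowerN_mul (lowerN_inv hn') hn)
    (h1 ▸ upperB_mul hy' (upperB_inv hy))
  rw [h2] at h1
  exact (mul_inv_eq_one.1 h1.symm).symm

theorem sum_fin_eq_sum_fin {n d : ℕ} (hd : d ≤ n) (F : ℕ → ℂ) (hF : ∀ k, d ≤ k → F k = 0) :
    ∑ k : Fin n, F k = ∑ k : Fin d, F k := by
  rw [← Finset.sum_range, ← Finset.sum_range]
  symm
  refine Finset.sum_subset (Finset.range_mono hd) fun k _ hk => hF k (by simpa using hk)

theorem mul_apply_entries (x y : G r) (a b : Fin (r + 1)) :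
    (x * y) a b = ∑ k : Fin (r + 1), entries x a k * entries y k b := by
  rw [Matrix.SpecialLinearGroup.coe_mul, Matrix.mul_apply]
  simp only [entries_coe]

/-- A matrix whose leading principal minors do not vanish has a factorization into a lower
unitriangular and an upper triangular matrix. -/
theorem exists_lowerN_mul_upperB (y : G r)
    (h : ∀ d ≤ r, (Matrix.of fun i k : Fin d => entries y i k).det ≠ 0) :
    ∃ n ∈ lowerN r, ∃ b ∈ upperB r, y = n * b := by
  have hrow : ∀ d ≤ r, ∃ v : Fin d → ℂ, ∀ b < d,
      ∑ i : Fin d, v i * entries y i b + entries y d b = 0 := by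
    intro d hd
    have hu := (Matrix.isUnit_iff_isUnit_det _).2 (isUnit_iff_ne_zero.2 (h d hd))
    obtain ⟨v, hv⟩ := Matrix.vecMul_surjective_iff_isUnit.2 hu fun b : Fin d => -entries y d b
    refine ⟨v, fun b hb => ?_⟩
    have := congrFun hv ⟨b, hb⟩
    simp only [Matrix.vecMul, dotProduct, Matrix.of_apply] at this
    rw [this, neg_add_cancel]
  choose v hv using fun d : Fin (r + 1) => hrow d (by omega)
  let nM : Matrix (Fin (r + 1)) (Fin (r + 1)) ℂ := Matrix.of fun a b =>
    if hb : b < a then v a ⟨b, hb⟩ else if a = b then 1 else 0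
  have hlow : ∀ a b, a < b → nM a b = 0 := fun a b hab => by
    simp [nM, hab.not_gt, hab.ne]
  have hdiag : ∀ a, nM a a = 1 := fun a => by simp [nM]
  have hdet : nM.det = 1 := by
    rw [Matrix.det_of_isLowerTriangular _ fun a b hab => hlow a b hab]
    exact Finset.prod_eq_one fun a _ => hdiag a
  set n : G r := ⟨nM, hdet⟩ with hn
  have hnN : n ∈ lowerN r := ⟨hlow, hdiag⟩
  refine ⟨n⁻¹, lowerN_inv hnN, n * y, fun a b hab => ?_, by group⟩
  rw [← hv a b hab, mul_apply_entries, sum_fin_eq_sum_fin (d := a + 1) (by omega)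
    fun k => entries n a k * entries y k b, Fin.sum_univ_castSucc]
  · congr 1
    · refine Finset.sum_congr rfl fun i _ => ?_
      have h1 : entries n a i = v a i := by
        rw [entries_of_lt _ a.2 (by omega)]
        exact dif_pos i.2
      rw [Fin.val_castSucc, h1]
    · rw [Fin.val_last, entries_coe n a a, hnN.2, one_mul]
  · intro k hk
    rw [entries_eq_zero hnN.1 _ _ hk, zero_mul]

/-! ### The cell and the twist -/

theorem inv_wordBar_longWord_apply (i b : Fin (r + 1)) :
    (wordBar (longWord r))⁻¹ i b = if b = i.rev then (-1) ^ (i : ℕ) else 0 := by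
  have h := inv_wordBar_longWord_mul_apply (1 : G r) i b
  rw [mul_one, entries_of_lt _ (by omega) b.2] at h
  rw [h]
  have : (⟨r - (i : ℕ), by omega⟩ : Fin (r + 1)) = i.rev := by ext; simp
  simp [this, Matrix.one_apply, eq_comm]

theorem mul_inv_wordBar_longWord_apply (x : G r) (i b : Fin (r + 1)) :
    (x * (wordBar (longWord r))⁻¹) i b.rev = x i b * (-1) ^ (b : ℕ) := by
  rw [Matrix.SpecialLinearGroup.coe_mul, Matrix.mul_apply, Finset.sum_eq_single b]
  · simp [inv_wordBar_longWord_apply]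
  · intro k _ hk
    rw [inv_wordBar_longWord_apply, if_neg fun h => hk (Fin.rev_injective h.symm), mul_zero]
  · simp

/-- Conjugation by the representative of `w₀` rotates a matrix by a half-turn, up to signs. -/
theorem apply_of_mul_inv_eq {l g : G r}
    (h : l * (wordBar (longWord r))⁻¹ = (wordBar (longWord r))⁻¹ * g) (i b : Fin (r + 1)) :
    l i b * (-1) ^ (b : ℕ) = (-1) ^ (i : ℕ) * g i.rev b.rev := by
  rw [← mul_inv_wordBar_longWord_apply, h, inv_wordBar_longWord_mul_apply,
    entries_of_lt _ (by omega) b.rev.2]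
  have : (⟨r - (i : ℕ), by omega⟩ : Fin (r + 1)) = i.rev := by ext; simp
  rw [this]

theorem conj_mem_lowerB {g : G r} (hg : g ∈ upperB r) :
    (wordBar (longWord r))⁻¹ * g * wordBar (longWord r) ∈ lowerB r := by
  intro i b hib
  have h := apply_of_mul_inv_eq (l := (wordBar (longWord r))⁻¹ * g * wordBar (longWord r)) (g := g)
    (by group) i b
  rw [hg _ _ (Fin.rev_lt_rev.2 hib), mul_zero] at h
  exact (mul_eq_zero.1 h).resolve_right (pow_ne_zero _ (by norm_num))

theorem conj_mem_upperN {n : G r} (hn : n ∈ lowerN r) :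
    wordBar (longWord r) * n * (wordBar (longWord r))⁻¹ ∈ upperN r := by
  have h := apply_of_mul_inv_eq (l := n)
    (g := wordBar (longWord r) * n * (wordBar (longWord r))⁻¹) (by group)
  refine ⟨fun i b hib => ?_, fun i => ?_⟩
  · have := h i.rev b.rev
    rw [hn.1 _ _ (Fin.rev_lt_rev.2 hib), zero_mul, Fin.rev_rev, Fin.rev_rev] at this
    exact (mul_eq_zero.1 this.symm).resolve_left (pow_ne_zero _ (by norm_num))
  · have := h i.rev i.rev
    rw [hn.2, Fin.rev_rev, one_mul] at this
    exact (mul_left_cancel₀ (pow_ne_zero _ (by norm_num)) ((mul_one _).trans this)).symm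

/-- The cell `G^{w₀,e}` consists of the lower triangular matrices `x` with `w₀⁻¹ x ∈ N⁻ B`. -/
theorem mem_cell_iff (x : G r) : x ∈ cell (longWord r) ↔
    x ∈ lowerB r ∧ ∃ n ∈ lowerN r, ∃ y ∈ upperB r, (wordBar (longWord r))⁻¹ * x = n * y := by
  constructor
  · rintro ⟨⟨b, hb, b', hb', rfl⟩, e, he, e', he', h⟩
    refine ⟨?_, ?_⟩
    · rw [h, mul_one]
      exact lowerB_mul he he'
    · obtain ⟨n, hn, h, hh, hnh⟩ := exists_lowerN_mul_torus (conj_mem_lowerB hb)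
      refine ⟨n, hn, h * b', upperB_mul (fun i j hij => hh _ _ hij.ne') hb', ?_⟩
      rw [← mul_assoc n, ← hnh]
      group
  · rintro ⟨hx, n, hn, y, hy, h⟩
    refine ⟨⟨_, (conj_mem_upperN hn).1, y, hy, ?_⟩, x, hx, 1, fun i j hij => ?_, by group⟩
    · rw [inv_mul_cancel_right, mul_assoc, ← h]
      group
    · exact Matrix.one_apply_ne hij.ne

theorem signConj_one : signConj (1 : G r) = 1 :=
  signConj_torus fun _ _ hij => Matrix.one_apply_ne hij

theorem signConj_inv (g : G r) : signConj g⁻¹ = (signConj g)⁻¹ := by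
  rw [eq_inv_iff_mul_eq_one, ← signConj_mul, inv_mul_cancel, signConj_one]

theorem signConj_signConj (g : G r) : signConj (signConj g) = g := by
  ext a b
  rw [signConj_apply, signConj_apply]
  have hp : ∀ k : ℕ, ((-1 : ℂ) ^ k) * (-1) ^ k = 1 := fun k => by rw [← mul_pow]; norm_num
  linear_combination ((-1) ^ (b : ℕ) * (-1) ^ (b : ℕ) * g a b) * hp a + g a b * hp b

/-- The maps `θ` and `ι` compose to the transposition. -/
theorem iota_theta (g : G r) : iota (theta g) = g.transpose := by
  rw [iota, theta, ← signConj_inv, signConj_signConj, transpose_inv, inv_inv]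

/-- The twist of `x` is the transpose of the factor in `B` of `w₀⁻¹ x ∈ N⁻ B`. -/
theorem mem_twist_iff (x z : G r) : z ∈ twist (longWord r) x ↔ x ∈ lowerB r ∧ z ∈ lowerB r ∧
    ∃ n ∈ lowerN r, (wordBar (longWord r))⁻¹ * x = n * z.transpose := by
  have hg : ∀ hx : (wordBar (longWord r))⁻¹ * x ∈ gaussSet r,
      gaussMinus _ hx ∈ lowerN r ∧
        (gaussMinus _ hx)⁻¹ * ((wordBar (longWord r))⁻¹ * x) ∈ upperB r := by
    intro hx
    obtain ⟨h1, h, hh, b, hb, he⟩ := hx.choose_spec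
    refine ⟨h1, ?_⟩
    have : (gaussMinus _ hx)⁻¹ * ((wordBar (longWord r))⁻¹ * x) = h * b := by
      rw [inv_mul_eq_iff_eq_mul, ← mul_assoc]
      exact he
    rw [this]
    exact upperB_mul (fun i j hij => hh _ _ hij.ne') hb.1
  have hv : ∀ h, iota ((zeta (longWord r) x).get h) =
      ((gaussMinus _ h.2)⁻¹ * ((wordBar (longWord r))⁻¹ * x)).transpose := fun h => iota_theta _
  constructor
  · intro hz
    obtain ⟨t, ⟨h, rfl⟩, rfl⟩ := (Part.mem_map_iff _).1 hz
    obtain ⟨h1, h2⟩ := hg h.2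
    refine ⟨((mem_cell_iff x).1 h.1).1, ?_, _, h1, ?_⟩
    · rw [hv]
      exact fun i j hij => h2 _ _ hij
    · rw [hv, transpose_transpose, mul_inv_cancel_left]
  · rintro ⟨hx, hz, n, hn, he⟩
    have h1 : x ∈ cell (longWord r) :=
      (mem_cell_iff x).2 ⟨hx, n, hn, _, transpose_mem_upperB hz, he⟩
    have h2 : (wordBar (longWord r))⁻¹ * x ∈ gaussSet r :=
      he ▸ lowerN_mul_upperB_mem_gaussSet hn (transpose_mem_upperB hz)
    refine (Part.mem_map_iff _).2 ⟨_, ⟨⟨h1, h2⟩, rfl⟩, ?_⟩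
    obtain ⟨h3, h4⟩ := hg h2
    refine (hv ⟨h1, h2⟩).trans ?_
    rw [eq_of_lowerN_mul_upperB_eq h3 hn h4 (transpose_mem_upperB hz)
      (by rw [mul_inv_cancel_left, he]), transpose_transpose]

theorem twist_injective {x x' z : G r} (h : z ∈ twist (longWord r) x)
    (h' : z ∈ twist (longWord r) x') : x = x' := by
  obtain ⟨hx, _, n, hn, he⟩ := (mem_twist_iff _ _).1 h
  obtain ⟨hx', _, n', hn', he'⟩ := (mem_twist_iff _ _).1 h'
  have h1 : x * x'⁻¹ = wordBar (longWord r) * (n * n'⁻¹) * (wordBar (longWord r))⁻¹ := by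
    rw [inv_mul_eq_iff_eq_mul] at he he'
    rw [he, he']
    group
  have h2 := conj_mem_upperN (lowerN_mul hn (lowerN_inv hn'))
  rw [← h1] at h2
  have h3 : x * x'⁻¹ ∈ lowerB r := lowerB_mul hx (lowerB_inv hx')
  exact mul_inv_eq_one.1 (eq_one_of_mem_lowerN_of_mem_upperB ⟨h3, h2.2⟩ h2.1)

theorem exists_mem_twist {x : G r} (hx : x ∈ cell (longWord r)) : ∃ z, z ∈ twist (longWord r) x := by
  obtain ⟨h, n, hn, y, hy, he⟩ := (mem_cell_iff x).1 hx
  exact ⟨y.transpose, (mem_twist_iff _ _).2 ⟨h, transpose_mem_lowerB hy, n, hn, he⟩⟩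

/-- The twist maps the cell to itself. -/
theorem twist_mem_cell {x z : G r} (h : z ∈ twist (longWord r) x) : z ∈ cell (longWord r) := by
  obtain ⟨hx, hz, n, hn, he⟩ := (mem_twist_iff _ _).1 h
  have hw : (wordBar (longWord r))⁻¹ * ((wordBar (longWord r))⁻¹).transpose = 1 := by
    ext i k
    have hi : (⟨r - (i : ℕ), by omega⟩ : Fin (r + 1)) = i.rev := by ext; simp
    rw [inv_wordBar_longWord_mul_apply, entries_of_lt _ (by omega) k.2, hi]
    change _ * (wordBar (longWord r))⁻¹ k i.rev = _
    rw [inv_wordBar_longWord_apply]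
    by_cases hik : i = k
    · subst hik
      rw [if_pos rfl, ← mul_pow]
      simp
    · simp [hik]
  obtain ⟨m, hm, t, ht, hmt⟩ := exists_lowerN_mul_torus (conj_mem_lowerB (transpose_mem_upperB hx))
  refine (mem_cell_iff z).2 ⟨hz, m, hm, t * (n⁻¹).transpose,
    upperB_mul (fun i j hij => ht _ _ hij.ne') (transpose_mem_upperB (lowerN_inv hn).1), ?_⟩
  have hz' : z = x.transpose * ((wordBar (longWord r))⁻¹).transpose * (n⁻¹).transpose := by
    rw [← transpose_mul, ← transpose_mul, he, inv_mul_cancel_left, transpose_transpose]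
  rw [← mul_assoc m, ← hmt, hz', eq_inv_of_mul_eq_one_right hw]
  group

/-- The minors of `w₀⁻¹ x` in the first `d` rows agree, up to a common factor, with the minors of `x`
in the last `d` rows. -/
theorem exists_det_inv_wordBar_longWord (r : ℕ) {d : ℕ} (hd : d ≤ r + 1) :
    ∃ κ : ℂ, κ ≠ 0 ∧ ∀ (x : G r) (f : Fin d → ℕ), (∀ k, f k < r + 1) →
      (Matrix.of fun i k : Fin d => entries ((wordBar (longWord r))⁻¹ * x) i (f k)).det =
        κ * (Matrix.of fun i k : Fin d => entries x (r + 1 - d + i) (f k)).det := by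
  refine ⟨(∏ i : Fin d, (-1) ^ (i : ℕ)) * (Equiv.Perm.sign (Fin.revPerm (n := d)) : ℤ), ?_, ?_⟩
  · refine mul_ne_zero (Finset.prod_ne_zero_iff.2 fun _ _ => pow_ne_zero _ (by norm_num)) ?_
    rcases Int.units_eq_one_or (Equiv.Perm.sign (Fin.revPerm (n := d))) with h | h <;> simp [h]
  · intro x f hf
    rw [mul_assoc, ← Matrix.det_permute, ← Matrix.det_mul_column]
    congr 1
    ext i k
    simp only [Matrix.of_apply, Matrix.submatrix_apply, Fin.revPerm_apply, id, Fin.val_rev]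
    rw [entries_of_lt _ (by omega) (hf k), inv_wordBar_longWord_mul_apply]
    congr 2
    have := i.2
    simp only
    omega

/-- The minors of the twist `z` of `x`. -/
theorem exists_det_twist {x z : G r} (h : z ∈ twist (longWord r) x) {d : ℕ} (hd : d ≤ r + 1) :
    ∃ κ : ℂ, κ ≠ 0 ∧ ∀ f : Fin d → ℕ, (∀ k, f k < r + 1) → (∀ k i, k < i → f k < i) →
      ∏ i, entries z (f i) i = κ * (Matrix.of fun i k : Fin d =>
        entries x (r + 1 - d + i) (f k)).det := by
  obtain ⟨hx, hz, n, hn, he⟩ := (mem_twist_iff _ _).1 h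
  obtain ⟨κ, hκ, hκ'⟩ := exists_det_inv_wordBar_longWord r hd
  refine ⟨κ, hκ, fun f hf hf' => ?_⟩
  rw [← hκ' x f hf]
  have hmul : (Matrix.of fun i k : Fin d => entries ((wordBar (longWord r))⁻¹ * x) i (f k)) =
      (Matrix.of fun i k : Fin d => entries n i k) * Matrix.of fun i k : Fin d => entries z (f k) i := by
    ext i k
    rw [Matrix.mul_apply, Matrix.of_apply, entries_of_lt _ (by omega) (hf k), he, mul_apply_entries,
      sum_fin_eq_sum_fin hd fun l => entries n i l * entries z.transpose l (f k)]
    · refine Finset.sum_congr rfl fun l _ => ?_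
      rw [Matrix.of_apply, Matrix.of_apply, entries_of_lt z (hf k) (by omega),
        entries_of_lt z.transpose (by omega) (hf k)]
      rfl
    · intro l hl
      rw [entries_eq_zero hn.1 _ _ (by omega), zero_mul]
  have hdet : (Matrix.of fun i k : Fin d => entries n i k).det = 1 := by
    rw [Matrix.det_of_isLowerTriangular (Matrix.of fun i k : Fin d => entries n i k)
      fun i k hik => entries_eq_zero hn.1 _ _ hik]
    refine Finset.prod_eq_one fun i _ => ?_
    rw [Matrix.of_apply, entries_of_lt _ (by omega) (by omega)]
    exact hn.2 _
  rw [hmul, Matrix.det_mul, hdet, one_mul, Matrix.det_of_isUpperTriangular]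
  · rfl
  · intro i k hik
    exact entries_eq_zero hz _ _ (hf' _ _ hik)

/-- The function `χ_j` at the twist of `x`. -/
theorem chi_twist {x z : G r} (h : z ∈ twist (longWord r) x) (j : Fin r) :
    chi j z = skipMinor (entries x) (r - j) j / solidMinor (entries x) (r - j) (j + 1) := by
  obtain ⟨κ, hκ, hκ'⟩ := exists_det_twist h (d := j + 1) (by omega)
  have hz := ((mem_twist_iff _ _).1 h).2.1
  have h1 := hκ' (fun k => k) (fun k => by omega) fun k i hki => hki
  have h2 := hκ' (fun k => if (k : ℕ) < j then k else j + 1)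
    (fun k => by split_ifs <;> omega) (fun k i hki => by
      rw [Fin.lt_def] at hki
      split_ifs <;> omega)
  rw [show r + 1 - (j + 1) = r - (j : ℕ) by omega, Fin.prod_univ_castSucc] at h1 h2
  have e1 : ∏ i : Fin (j : ℕ), entries z (if ((i.castSucc : Fin (j + 1)) : ℕ) < j then
      ((i.castSucc : Fin (j + 1)) : ℕ) else j + 1) (i.castSucc : Fin (j + 1)) =
      ∏ i : Fin (j : ℕ), entries z (i.castSucc : Fin (j + 1)) (i.castSucc : Fin (j + 1)) :=
    Finset.prod_congr rfl fun i _ => by simp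
  rw [e1] at h2
  have hd : ∀ a, a < r + 1 → entries z a a ≠ 0 := fun a ha => by
    rw [entries_of_lt _ ha ha]; exact diag_ne_zero hz _
  have hp : ∏ i : Fin (j : ℕ), entries z (i.castSucc : Fin (j + 1)) (i.castSucc : Fin (j + 1)) ≠ 0 :=
    Finset.prod_ne_zero_iff.2 fun i _ => hd _ (by simp; omega)
  simp only [Fin.val_last, lt_irrefl, if_false] at h1 h2
  have hj := hd j (by omega)
  change _ = κ * solidMinor (entries x) (r - j) (j + 1) at h1
  change _ = κ * skipMinor (entries x) (r - j) j at h2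
  have hs : solidMinor (entries x) (r - j) (j + 1) ≠ 0 := by
    intro h0
    rw [h0, mul_zero] at h1
    exact mul_ne_zero hp hj h1
  have hc : chi j z = entries z (j + 1) j / entries z j j := by
    rw [entries_of_lt _ (by omega) (by omega), entries_of_lt _ (by omega) (by omega)]
    rfl
  rw [hc, div_eq_div_iff hj hs]
  apply mul_left_cancel₀ (mul_ne_zero hκ hp)
  generalize (∏ i : Fin (j : ℕ), entries z (i.castSucc : Fin (j + 1)) (i.castSucc : Fin (j + 1))) = p at *
  linear_combination (-p * entries z (j + 1) j) * h1 + (p * entries z j j) * h2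

/-! ### The map `p` in the double indexing -/

theorem num_seedIndex_zero {d : ℕ} (h : IsSeedPlace r 0 d) :
    num (longWord r) (seedIndex r 0 d h) = -(d : ℤ) := by
  have := h.1
  simp only [seedIndex, dite_true, num]
  omega

theorem num_seedIndex {m d : ℕ} (hm : m ≠ 0) (h : IsSeedPlace r m d) :
    num (longWord r) (seedIndex r m d h) =
      (∑ l ∈ Finset.range (m - 1), (r - l) : ℕ) + (d : ℤ) := by
  have := h.1
  simp only [seedIndex, hm, dite_false, num, place]
  omega

theorem num_seedIndex_lt_of_lt {m d m' d' : ℕ} (h : IsSeedPlace r m d) (h' : IsSeedPlace r m' d')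
    (hm : m < m') : num (longWord r) (seedIndex r m d h) < num (longWord r) (seedIndex r m' d' h') := by
  have h1 := h.1
  have h3 := h.2.2
  have h1' := h'.1
  rw [num_seedIndex (by omega) h']
  rcases Nat.eq_zero_or_pos m with rfl | hm0
  · rw [num_seedIndex_zero]
    omega
  · rw [num_seedIndex (by omega) h]
    have hs : ∑ l ∈ Finset.range m, (r - l) ≤ ∑ l ∈ Finset.range (m' - 1), (r - l) :=
      Finset.sum_le_sum_of_subset (Finset.range_mono (by omega))
    obtain ⟨m, rfl⟩ := Nat.exists_eq_add_of_le' hm0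
    rw [Finset.sum_range_succ] at hs
    rw [Nat.add_sub_cancel]
    omega

/-- The numbering of the indices is lexicographic, as long as they are not both negative. -/
theorem num_seedIndex_lt_iff {m d m' d' : ℕ} (h : IsSeedPlace r m d) (h' : IsSeedPlace r m' d')
    (hm : m ≠ 0 ∨ m' ≠ 0) :
    num (longWord r) (seedIndex r m d h) < num (longWord r) (seedIndex r m' d' h') ↔
      m < m' ∨ m = m' ∧ d < d' := by
  rcases lt_trichotomy m m' with hlt | rfl | hgt
  · simp [hlt, num_seedIndex_lt_of_lt h h' hlt]
  · rw [num_seedIndex (by omega) h, num_seedIndex (by omega) h']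
    omega
  · have := num_seedIndex_lt_of_lt h' h hgt
    constructor <;> intro <;> omega

theorem seedIndex_eq_iff {m d m' d' : ℕ} (h : IsSeedPlace r m d) (h' : IsSeedPlace r m' d') :
    seedIndex r m d h = seedIndex r m' d' h' ↔ m = m' ∧ d = d' := by
  constructor
  · intro he
    have h1 := letter_seedIndex h
    have h2 := letter_seedIndex h'
    rw [he] at h1
    refine ⟨?_, by have := h.1; have := h'.1; omega⟩
    rcases lt_trichotomy m m' with hlt | rfl | hgt
    · have := num_seedIndex_lt_of_lt h h' hlt
      rw [he] at this
      omega
    · rfl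
    · have := num_seedIndex_lt_of_lt h' h hgt
      rw [he] at this
      omega
  · rintro ⟨rfl, rfl⟩
    rfl

theorem succIdx_seedIndex {m d : ℕ} (h : IsSeedPlace r m d) (h' : IsSeedPlace r (m + 1) d) :
    succIdx (longWord r) (seedIndex r m d h) = num (longWord r) (seedIndex r (m + 1) d h') := by
  apply le_antisymm
  · refine succIdx_le_num _ (num_seedIndex_lt_of_lt h h' (by omega)) (Fin.ext ?_)
    rw [letter_seedIndex, letter_seedIndex]
  · rcases succIdx_spec (longWord r) (seedIndex r m d h) with hs | ⟨l, h1, h2, h3⟩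
    · have := num_le (longWord r) (seedIndex r (m + 1) d h')
      omega
    · obtain ⟨m', d', hl, rfl⟩ := exists_seedIndex l
      have hd := congrArg Fin.val h2
      rw [letter_seedIndex, letter_seedIndex] at hd
      obtain rfl : d' = d := by have := h.1; have := hl.1; omega
      rw [h3]
      by_contra! hlt
      rw [num_seedIndex_lt_iff _ _ (by omega)] at hlt
      rcases Nat.lt_or_ge m' m with hm | hm
      · have := num_seedIndex_lt_of_lt hl h hm
        omega
      · obtain rfl : m' = m := by omega
        omega

theorem succIdx_seedIndex_last {m d : ℕ} (h : IsSeedPlace r m d) (h' : m + d = r + 1) :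
    succIdx (longWord r) (seedIndex r m d h) = (longWord r).length + 1 := by
  rcases succIdx_spec (longWord r) (seedIndex r m d h) with hs | ⟨l, h1, h2, h3⟩
  · exact hs
  · obtain ⟨m', d', hl, rfl⟩ := exists_seedIndex l
    have hd := congrArg Fin.val h2
    rw [letter_seedIndex, letter_seedIndex] at hd
    obtain rfl : d' = d := by have := h.1; have := hl.1; omega
    have := hl.2.2
    rcases Nat.lt_or_ge m' m with hm | hm
    · have := num_seedIndex_lt_of_lt hl h hm
      omega
    · obtain rfl : m' = m := by omega
      omega

theorem bracket_congr {P Q : Prop} [Decidable P] [Decidable Q] (h : P ↔ Q) : bracket P = bracket Q := by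
  unfold bracket
  simp only [h]

/-- The row of the matrix `B + M` at a place that is not the last one of its letter. -/
theorem extendedMatrix_seedIndex {l d m e : ℕ} (hl : 1 ≤ l) (h : IsSeedPlace r l d) (hld : l + d ≤ r)
    (h' : IsSeedPlace r m e) :
    extendedMatrix (longWord r) (seedIndex r l d h) (seedIndex r m e h') =
      bracket (m = l + 1 ∧ e = d) - bracket (m = l - 1 ∧ e = d) - bracket (m = l ∧ e = d + 1) +
        bracket (m = l ∧ e = d - 1) + bracket (m = l - 1 ∧ e = d + 1) -
        bracket (m = l + 1 ∧ e = d - 1) := by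
  have hd := h.1
  have he := h'.1
  have hme := h'.2.2
  have ha : ((CartanMatrix.A r (letter (longWord r) (seedIndex r m e h'))
      (letter (longWord r) (seedIndex r l d h)) : ℤ) : ℚ) =
      if e = d then 2 else if e + 1 = d ∨ d + 1 = e then -1 else 0 := by
    have h1 := letter_seedIndex h
    have h2 := letter_seedIndex h'
    simp only [CartanMatrix.A, Matrix.of_apply, Fin.ext_iff, h1, h2]
    split_ifs <;> first | omega | simp
  have hj1 : IsSeedPlace r (l + 1) d := ⟨h.1, h.2.1, by omega⟩
  simp only [extendedMatrix, exchangeMatrix, frozenMatrix, bracket_mul]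
  rw [ha, ← mul_add]
  by_cases hfar : e = d ∨ e + 1 = d ∨ d + 1 = e
  swap
  · simp [bracket, show ¬ e = d by omega, show ¬ (e + 1 = d ∨ d + 1 = e) by omega,
      show ¬ e = d + 1 by omega, show ¬ e = d - 1 by omega]
  have hn : ∀ k, num (longWord r) k ≤ (longWord r).length := num_le _
  have hpos : 0 < num (longWord r) (seedIndex r l d h) := by
    rw [num_seedIndex (by omega)]; omega
  have hpos' : 0 < num (longWord r) (seedIndex r m e h') ↔ m ≠ 0 := by
    by_cases hm : m = 0
    · subst hm
      rw [num_seedIndex_zero]; omega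
    · rw [num_seedIndex hm]; omega
  have c1 := num_seedIndex_lt_iff h h' (by omega)
  have c2 := num_seedIndex_lt_iff h' h (by omega)
  have c3 := num_seedIndex_lt_iff hj1 h' (by omega)
  have c4 := num_seedIndex_lt_iff h' hj1 (by omega)
  rw [succIdx_seedIndex h hj1]
  have n1 := hn (seedIndex r (l + 1) d hj1)
  have n2 := hn (seedIndex r l d h)
  have n3 := hn (seedIndex r m e h')
  have key : (num (longWord r) (seedIndex r l d h) = succIdx (longWord r) (seedIndex r m e h') ↔
        m = l - 1 ∧ e = d) ∧
      (num (longWord r) (seedIndex r (l + 1) d hj1) = num (longWord r) (seedIndex r m e h') ↔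
        m = l + 1 ∧ e = d) ∧
      ((num (longWord r) (seedIndex r m e h') < num (longWord r) (seedIndex r l d h) ∧
          num (longWord r) (seedIndex r l d h) < succIdx (longWord r) (seedIndex r m e h')) ∧
          0 < num (longWord r) (seedIndex r l d h) ↔
        m = l ∧ e < d ∨ m = l - 1 ∧ d < e) ∧
      ((num (longWord r) (seedIndex r m e h') < num (longWord r) (seedIndex r (l + 1) d hj1) ∧
          num (longWord r) (seedIndex r (l + 1) d hj1) <
            succIdx (longWord r) (seedIndex r m e h')) ∧
          num (longWord r) (seedIndex r (l + 1) d hj1) ≤ ((longWord r).length : ℤ) ↔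
        m = l + 1 ∧ e < d ∨ m = l ∧ d < e) ∧
      ((num (longWord r) (seedIndex r l d h) < num (longWord r) (seedIndex r m e h') ∧
          num (longWord r) (seedIndex r m e h') < num (longWord r) (seedIndex r (l + 1) d hj1)) ∧
          0 < num (longWord r) (seedIndex r m e h') ↔
        m = l + 1 ∧ e < d ∨ m = l ∧ d < e) ∧
      ((num (longWord r) (seedIndex r l d h) < succIdx (longWord r) (seedIndex r m e h') ∧
          succIdx (longWord r) (seedIndex r m e h') <
            num (longWord r) (seedIndex r (l + 1) d hj1)) ∧
          succIdx (longWord r) (seedIndex r m e h') ≤ ((longWord r).length : ℤ) ↔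
        m = l ∧ e < d ∨ m = l - 1 ∧ d < e) := by
    by_cases hlast : m + e = r + 1
    · rw [succIdx_seedIndex_last h' hlast]
      refine ⟨?_, ?_, ?_, ?_, ?_, ?_⟩ <;> omega
    · have hk1 : IsSeedPlace r (m + 1) e := ⟨he, h'.2.1, by omega⟩
      have n4 := hn (seedIndex r (m + 1) e hk1)
      have c5 := num_seedIndex_lt_iff h hk1 (by omega)
      have c6 := num_seedIndex_lt_iff hk1 h (by omega)
      have c7 := num_seedIndex_lt_iff hj1 hk1 (by omega)
      have c8 := num_seedIndex_lt_iff hk1 hj1 (by omega)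
      rw [succIdx_seedIndex h' hk1]
      refine ⟨?_, ?_, ?_, ?_, ?_, ?_⟩ <;> omega
  obtain ⟨k1, k2, k3, k4, k5, k6⟩ := key
  rw [bracket_congr k1, bracket_congr k2, bracket_congr k3, bracket_congr k4, bracket_congr k5,
    bracket_congr k6, show bracket (((longWord r).length : ℤ) <
      num (longWord r) (seedIndex r (l + 1) d hj1) ∧ _) = 0 from if_neg (by omega),
    show bracket (num (longWord r) (seedIndex r l d h) < 0 ∧ _) = 0 from if_neg (by omega)]
  clear k1 k2 k3 k4 k5 k6 c1 c2 c3 c4 n1 n2 n3 hn hpos hpos' ha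
  unfold bracket
  rcases hfar with rfl | rfl | rfl
  · simp [show ¬ e = e - 1 by omega]
    ring
  · simp [show ¬ e = e + 1 + 1 by omega]
    ring
  · simp [show ¬ d + 1 = d - 1 by omega]
    ring

open scoped Classical in
/-- The coordinate of a point of a cluster torus of `longWord r` at `seedIndex r m d`, and `1` where
that is not defined. The latter is the value of the empty minor for `d = 0`, and of the determinant
for `m = 0` and `d = r + 1`. -/
noncomputable def seedCoord {R : Type*} [One R] (A : SeedIndex (longWord r) → R) (m d : ℕ) : R :=
  if h : IsSeedPlace r m d then A (seedIndex r m d h) else 1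

theorem seedCoord_of_isSeedPlace {R : Type*} [One R] (A : SeedIndex (longWord r) → R) {m d : ℕ}
    (h : IsSeedPlace r m d) : seedCoord A m d = A (seedIndex r m d h) := dif_pos h

theorem seedCoord_zero_right {R : Type*} [One R] (A : SeedIndex (longWord r) → R) (m : ℕ) :
    seedCoord A m 0 = 1 := dif_neg fun h => by have := h.1; omega

theorem seedCoord_zero_succ {R : Type*} [One R] (A : SeedIndex (longWord r) → R) :
    seedCoord A 0 (r + 1) = 1 := dif_neg fun h => by have := h.2.1; omega

theorem map_seedCoord {R S : Type*} [One R] [One S] (f : R → S) (hf : f 1 = 1)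
    (A : SeedIndex (longWord r) → R) (m d : ℕ) :
    f (seedCoord A m d) = seedCoord (fun k => f (A k)) m d := by
  unfold seedCoord
  split_ifs
  · rfl
  · exact hf

theorem coord_eq_seedCoord (A : SeedIndex (longWord r) → ℂˣ) {m d : ℕ} (hm : 1 ≤ m) (hd : 1 ≤ d)
    (hmd : m + d ≤ r + 1) : coord A m d = (seedCoord A m d : ℂˣ) := by
  rw [seedCoord_of_isSeedPlace A ⟨hd, by omega, hmd⟩, coord, dif_pos (place_lt_length hm hd hmd)]
  simp [seedIndex, show m ≠ 0 by omega]

open scoped Classical in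
theorem prod_zpow_ite (A : SeedIndex (longWord r) → ℂˣ) (m d : ℕ) :
    ∏ k, A k ^ (if ∃ h : IsSeedPlace r m d, k = seedIndex r m d h then (1 : ℤ) else 0) =
      seedCoord A m d := by
  by_cases h : IsSeedPlace r m d
  · rw [seedCoord_of_isSeedPlace A h, Finset.prod_eq_single (seedIndex r m d h)]
    · simp [h]
    · intro k _ hk
      simp [hk]
    · simp
  · simp [seedCoord, h]

/-- The monomial `A_{s-1,d+1} A_{s,d-1} / (A_{s,d} A_{s-1,d})`, for `s, d ≥ 1`. -/
noncomputable def stepRatio (v : ℕ → ℕ → ℂ) (d s : ℕ) : ℂ :=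
  v (s - 1) (d + 1) * v s (d - 1) / (v s d * v (s - 1) d)

theorem ensembleMap_seedIndex (A : SeedIndex (longWord r) → ℂˣ) {l d : ℕ} (hl : 1 ≤ l)
    (h : IsSeedPlace r l d) (hld : l + d ≤ r) :
    ensembleMap (longWord r) A (seedIndex r l d h) =
      seedCoord A (l + 1) d / seedCoord A (l - 1) d / seedCoord A l (d + 1) * seedCoord A l (d - 1) *
        seedCoord A (l - 1) (d + 1) / seedCoord A (l + 1) (d - 1) := by
  classical
  simp only [← prod_zpow_ite, ← Finset.prod_mul_distrib, ← Finset.prod_div_distrib]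
  refine Finset.prod_congr rfl fun k _ => ?_
  simp only [← zpow_add, div_eq_mul_inv, ← zpow_neg]
  congr 1
  obtain ⟨m, e, h', rfl⟩ := exists_seedIndex k
  have key : ∀ m' e', (∃ h'' : IsSeedPlace r m' e', seedIndex r m e h' = seedIndex r m' e' h'') ↔
      m = m' ∧ e = e' := fun m' e' =>
    ⟨fun ⟨_, h⟩ => (seedIndex_eq_iff _ _).1 h, by rintro ⟨rfl, rfl⟩; exact ⟨h', rfl⟩⟩
  simp only [key]
  rw [← @Int.cast_inj ℚ, extendedMatrix_eq_floor, extendedMatrix_seedIndex hl h hld h']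
  simp only [bracket]
  push_cast
  ring

/-- The coordinates of `p(A)` at the places that are not the last ones of their letters are the
successive quotients of the monomials `stepRatio`. -/
theorem coord_ensembleMap (A : SeedIndex (longWord r) → ℂˣ) {l d : ℕ} (hl : 1 ≤ l) (hd : 1 ≤ d)
    (hld : l + d ≤ r) :
    coord (ensembleMap (longWord r) A) l d =
      stepRatio (fun m d => (seedCoord A m d : ℂˣ)) d l /
        stepRatio (fun m d => (seedCoord A m d : ℂˣ)) d (l + 1) := by
  have h : IsSeedPlace r l d := ⟨hd, by omega, by omega⟩
  rw [coord_eq_seedCoord _ hl hd (by omega), seedCoord_of_isSeedPlace _ h,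
    ensembleMap_seedIndex A hl h hld]
  simp only [stepRatio, Nat.add_sub_cancel]
  push_cast
  field_simp

theorem stepRatio_ne_zero (A : SeedIndex (longWord r) → ℂˣ) (d s : ℕ) :
    stepRatio (fun m d => (seedCoord A m d : ℂˣ)) d s ≠ 0 := by
  simp [stepRatio]

theorem tailProd_ensembleMap (A : SeedIndex (longWord r) → ℂˣ) {d s : ℕ} (hd : 1 ≤ d) (hs : 1 ≤ s)
    (hsd : s ≤ r - d + 1) :
    tailProd (ensembleMap (longWord r) A) d s =
      stepRatio (fun m d => (seedCoord A m d : ℂˣ)) d s /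
        stepRatio (fun m d => (seedCoord A m d : ℂˣ)) d (r - d + 1) := by
  have key : ∀ N, N ≤ r - d → s ≤ N + 1 →
      ∏ l ∈ Finset.Icc s N, coord (ensembleMap (longWord r) A) l d =
        stepRatio (fun m d => (seedCoord A m d : ℂˣ)) d s /
          stepRatio (fun m d => (seedCoord A m d : ℂˣ)) d (N + 1) := by
    intro N
    induction N with
    | zero =>
      intro _ h
      obtain rfl : s = 1 := by omega
      simp [stepRatio_ne_zero]
    | succ N ih =>
      intro hN h
      rcases Nat.lt_or_ge (N + 1) s with h' | h'
      · obtain rfl : s = N + 2 := by omega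
        simp [stepRatio_ne_zero]
      · rw [← Finset.insert_Icc_right_eq_Icc_add_one h', Finset.prod_insert (by simp),
          ih (by omega) h', coord_ensembleMap A (by omega) hd (by omega)]
        have h1 := stepRatio_ne_zero A d (N + 1)
        have h2 := stepRatio_ne_zero A d (N + 1 + 1)
        field_simp
  exact key _ le_rfl hsd

/-! ### The cluster chart -/

theorem mem_chartInv_iff (A : SeedIndex (longWord r) → ℂˣ) (x : G r) :
    A ∈ chartInv (longWord r) x ↔ x ∈ cell (longWord r) ∧
      ∀ m d, m + d ≤ r + 1 → solidMinor (entries x) m d = (seedCoord A m d : ℂˣ) := by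
  constructor
  · rintro ⟨⟨hx, h⟩, rfl⟩
    refine ⟨hx, fun m d hmd => ?_⟩
    by_cases hp : IsSeedPlace r m d
    · rw [seedCoord_of_isSeedPlace _ hp, ← clusterMinor_seedIndex x hp]
      rfl
    · rcases Nat.eq_zero_or_pos d with rfl | hd
      · rw [solidMinor_zero, seedCoord_zero_right, Units.val_one]
      · have : ¬ (d ≤ r) := fun hd' => hp ⟨hd, hd', hmd⟩
        obtain rfl : d = r + 1 := by omega
        obtain rfl : m = 0 := by omega
        rw [solidMinor_entries_zero_succ, seedCoord_zero_succ, Units.val_one]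
  · rintro ⟨hx, h⟩
    have hk : ∀ k, clusterMinor (longWord r) k x = A k := by
      intro k
      obtain ⟨m, d, hp, rfl⟩ := exists_seedIndex k
      rw [clusterMinor_seedIndex, h _ _ hp.2.2, seedCoord_of_isSeedPlace _ hp]
    refine ⟨⟨hx, fun k => ?_⟩, ?_⟩
    · rw [hk]
      exact (A k).ne_zero
    · funext k
      exact Units.ext (hk k)

/-- A lower triangular matrix with nonvanishing minors in the last rows and first columns belongs to
the cell. -/
theorem mem_cell_of_solidMinor_ne_zero {x : G r} (hx : x ∈ lowerB r)
    (h : ∀ d ≤ r, solidMinor (entries x) (r + 1 - d) d ≠ 0) : x ∈ cell (longWord r) := by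
  refine (mem_cell_iff x).2 ⟨hx, exists_lowerN_mul_upperB _ fun d hd => ?_⟩
  obtain ⟨κ, hκ, hκ'⟩ := exists_det_inv_wordBar_longWord r (d := d) (by omega)
  rw [hκ' x (fun k => k) fun k => by omega]
  exact mul_ne_zero hκ (h d hd)

/-- The chart of `longWord r` is defined on the whole cluster torus. -/
theorem existsUnique_mem_chartInv (A : SeedIndex (longWord r) → ℂˣ) :
    ∃! x, A ∈ chartInv (longWord r) x := by
  obtain ⟨X, hX, hXA⟩ := exists_array (fun m d => (seedCoord A m d : ℂˣ)) (fun m d => Units.ne_zero _)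
    (r + 1)
  have hdet : (Matrix.of fun i k : Fin (r + 1) => X i k).det = 1 := by
    have := hXA 0 (r + 1) (by omega) le_rfl
    rw [seedCoord_zero_succ, Units.val_one] at this
    rw [← this, solidMinor]
    simp
  set x : G r := ⟨_, hdet⟩ with hx
  have hxl : x ∈ lowerB r := fun a b hab => hX a b hab
  have hminor : ∀ m d, m + d ≤ r + 1 → solidMinor (entries x) m d = (seedCoord A m d : ℂˣ) := by
    intro m d hmd
    rcases Nat.eq_zero_or_pos d with rfl | hd
    · rw [solidMinor_zero, seedCoord_zero_right, Units.val_one]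
    · rw [← hXA m d hd (by omega), solidMinor, solidMinor]
      congr 1
      ext i k
      exact entries_of_lt x (by omega) (by omega)
  refine ⟨x, (mem_chartInv_iff A x).2 ⟨mem_cell_of_solidMinor_ne_zero hxl fun d hd => ?_, hminor⟩,
    fun y hy => ?_⟩
  · rw [hminor _ _ (by omega)]
    exact Units.ne_zero _
  · obtain ⟨hyc, hy⟩ := (mem_chartInv_iff A y).1 hy
    apply entries_injective
    funext a b
    by_cases ha : a < r + 1
    · refine eq_of_solidMinor_eq (n := r + 1) (entries_eq_zero hxl)
        (entries_eq_zero ((mem_cell_iff y).1 hyc).1) (fun m d hmd => ?_) (fun m d hmd => ?_) b a ha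
      · rw [hminor m d hmd]
        exact Units.ne_zero _
      · rw [hminor m d hmd, hy m d hmd]
    · simp [entries, ha]

/-! ### The action in the chart -/

/-- The twist carries the crystal action to right multiplication by a one-parameter subgroup. -/
theorem twist_mul_yRoot {x z : G r} (h : z ∈ twist (longWord r) x) (j : Fin r) (c : ℂˣ)
    (hchi : chi j z ≠ 0) :
    xRoot j (((c : ℂ) - 1) * phi j z) * z * xRoot j (((c : ℂ)⁻¹ - 1) * eps j z) ∈
      twist (longWord r) (x * yRoot j (((c : ℂ) - 1) * phi j z)) := by
  obtain ⟨hx, hz, n, hn, he⟩ := (mem_twist_iff _ _).1 h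
  set s := ((c : ℂ) - 1) * phi j z with hs
  set t := ((c : ℂ)⁻¹ - 1) * eps j z with ht
  have hT : ∀ t, (xRoot j t).transpose = yRoot j t := by
    intro t
    ext a b
    change xRoot j t b a = _
    rw [xRoot_apply, yRoot_apply]
    simp only [eq_comm, and_comm]
  have hlt : j.castSucc < j.succ := Fin.castSucc_lt_succ
  have h1 := diag_ne_zero hz j.castSucc
  have h2 := diag_ne_zero hz j.succ
  -- The entry of the product at the place `(j, j + 1)`.
  have hcancel : s * z j.succ j.succ + t * (z j.castSucc j.castSucc + s * z j.succ j.castSucc) = 0 := by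
    have h3 : z j.succ j.castSucc ≠ 0 := fun h0 => hchi (by rw [chi, h0, zero_div])
    have hc : (c : ℂ) ≠ 0 := c.ne_zero
    rw [hs, ht, eps, phi, gamma, chi]
    field_simp
    ring
  refine (mem_twist_iff _ _).2 ⟨lowerB_mul hx (yRoot_mem_lowerN j s).1, fun a b hab => ?_,
    n * (yRoot j t)⁻¹, lowerN_mul hn (lowerN_inv (yRoot_mem_lowerN j t)), ?_⟩
  · have hz' : ∀ a b, a < b → z a b = 0 := hz
    simp only [mul_xRoot_apply, xRoot_mul_apply]
    by_cases ha : a = j.castSucc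
    · subst ha
      by_cases hb : b = j.succ
      · subst hb
        simp only [if_true]
        rw [hz' _ _ hlt]
        linear_combination hcancel
      · have hb' : j.succ < b := lt_of_le_of_ne (Fin.castSucc_lt_iff_succ_le.1 hab) (Ne.symm hb)
        simp [hb, hz' _ _ hab, hz' _ _ hb']
    · by_cases hb : b = j.succ
      · subst hb
        have ha' : a < j.castSucc := lt_of_le_of_ne (Fin.le_castSucc_iff.2 hab) ha
        simp [ha, hz' _ _ hab, hz' _ _ ha']
      · simp [ha, hb, hz' _ _ hab]
  · rw [← mul_assoc, he, transpose_mul, transpose_mul, hT, hT]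
    group

theorem mem_comp_iff {α β δ : Type} (f : β →. δ) (g : α →. β) (a : α) (b : δ) :
    b ∈ f.comp g a ↔ ∃ y, y ∈ g a ∧ b ∈ f y := Part.mem_bind_iff

/-- The composite of the twist, the crystal action and the inverse of the twist. -/
theorem mem_comp_twist_iff {x x' : G r} (j : Fin r) (c : ℂˣ) (hx : x ∈ cell (longWord r)) :
    x' ∈ ((partialInverse (twist (longWord r))).comp
      ((crystalAction (longWord r) j c).comp (twist (longWord r)))) x ↔
    skipMinor (entries x) (r - j) j / solidMinor (entries x) (r - j) (j + 1) ≠ 0 ∧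
      x' = x * yRoot j (((c : ℂ) - 1) *
        (skipMinor (entries x) (r - j) j / solidMinor (entries x) (r - j) (j + 1))⁻¹) := by
  obtain ⟨z, hz⟩ := exists_mem_twist hx
  rw [← chi_twist hz j, mem_comp_iff]
  simp only [mem_comp_iff]
  constructor
  · rintro ⟨_, ⟨z', hz', ⟨_, hchi⟩, rfl⟩, hx'⟩
    obtain rfl := Part.mem_unique hz hz'
    refine ⟨hchi, ?_⟩
    obtain ⟨hu, rfl⟩ := hx'
    exact (hu.choose_spec.2 _ (twist_mul_yRoot hz j c hchi)).symm
  · rintro ⟨hchi, rfl⟩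
    have h := twist_mul_yRoot hz j c hchi
    have hu : ∃! a, xRoot j (((c : ℂ) - 1) * phi j z) * z * xRoot j (((c : ℂ)⁻¹ - 1) * eps j z) ∈
        twist (longWord r) a := ⟨_, h, fun y hy => twist_injective hy h⟩
    refine ⟨_, ⟨z, hz, ⟨twist_mem_cell hz, hchi⟩, rfl⟩, hu, ?_⟩
    exact (hu.choose_spec.2 _ h).symm

/-- The sum of the monomials `stepRatio`, where the first `m` of them are multiplied by `c`. -/
noncomputable def weightedSum (A : SeedIndex (longWord r) → ℂˣ) (c : ℂ) (d m : ℕ) : ℂ :=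
  c * ∑ s ∈ Finset.Icc 1 m, stepRatio (fun m d => (seedCoord A m d : ℂˣ)) d s +
    ∑ s ∈ Finset.Icc (m + 1) (r - d + 1), stepRatio (fun m d => (seedCoord A m d : ℂˣ)) d s

/-- The action in the cluster torus: its domain, and its values. -/
theorem mem_twistedAction_iff (A A' : SeedIndex (longWord r) → ℂˣ) (j : Fin r) (c : ℂˣ) :
    A' ∈ twistedAction (longWord r) j c A ↔
      weightedSum A c (j + 1) 0 ≠ 0 ∧ ∀ m d (h : IsSeedPlace r m d),
        (A' (seedIndex r m d h) : ℂ) = A (seedIndex r m d h) *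
          if d = j + 1 then weightedSum A c (j + 1) m / weightedSum A c (j + 1) 0 else 1 := by
  obtain ⟨x, hx, huniq⟩ := existsUnique_mem_chartInv A
  have hchart : x ∈ chart (longWord r) A := by
    have hu : ∃! x, A ∈ chartInv (longWord r) x := ⟨x, hx, huniq⟩
    exact ⟨hu, huniq _ hu.choose_spec.1⟩
  obtain ⟨hxc, hxA⟩ := (mem_chartInv_iff A x).1 hx
  have hxl := ((mem_cell_iff x).1 hxc).1
  set q := stepRatio (fun m d => (seedCoord A m d : ℂˣ)) (j + 1) with hq
  have hQ : ∀ m ≤ r - (j : ℕ), skipMinor (entries x) m j / solidMinor (entries x) m (j + 1) =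
      ∑ s ∈ Finset.Icc 1 m, q s := by
    intro m hm
    rw [skipMinor_div_solidMinor (entries_eq_zero hxl)]
    · refine Finset.sum_congr rfl fun s hs => ?_
      rw [Finset.mem_Icc] at hs
      simp only [hq, stepRatio, Nat.add_sub_cancel]
      rw [hxA _ _ (by omega), hxA _ _ (by omega), hxA _ _ (by omega), hxA _ _ (by omega)]
    · intro l hl
      rw [hxA _ _ (by omega)]
      exact Units.ne_zero _
    · intro l hl
      rw [hxA _ _ (by omega)]
      exact Units.ne_zero _
  have hsum0 : weightedSum A c (j + 1) 0 = ∑ s ∈ Finset.Icc 1 (r - (j : ℕ)), q s := by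
    simp [weightedSum, hq, show r - ((j : ℕ) + 1) + 1 = r - j by omega]
  have hsum : ∀ m ≤ r - (j : ℕ), weightedSum A c (j + 1) m =
      weightedSum A c (j + 1) 0 + (c - 1) * ∑ s ∈ Finset.Icc 1 m, q s := by
    intro m hm
    have : ∑ s ∈ Finset.Icc 1 (r - (j : ℕ)), q s = ∑ s ∈ Finset.Icc 1 m, q s +
        ∑ s ∈ Finset.Icc (m + 1) (r - (j : ℕ)), q s := by
      have h1 : ∀ a b : ℕ, Finset.Icc a b = Finset.Ico a (b + 1) := fun a b => by
        ext; simp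
      rw [h1, h1, h1, Finset.sum_Ico_consecutive _ (by omega) (by omega)]
    rw [hsum0, this, weightedSum, show r - ((j : ℕ) + 1) + 1 = r - j by omega]
    ring
  have hmain : A' ∈ twistedAction (longWord r) j c A ↔ weightedSum A c (j + 1) 0 ≠ 0 ∧
      A' ∈ chartInv (longWord r) (x * yRoot j (((c : ℂ) - 1) * (weightedSum A c (j + 1) 0)⁻¹)) := by
    have : A' ∈ twistedAction (longWord r) j c A ↔
        ∃ x', x' ∈ ((partialInverse (twist (longWord r))).comp
        ((crystalAction (longWord r) j c).comp (twist (longWord r)))) x ∧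
          A' ∈ chartInv (longWord r) x' := by
      simp only [twistedAction, mem_comp_iff]
      constructor
      · rintro ⟨x', ⟨z', ⟨z, ⟨y, hy, hyz⟩, hzz'⟩, hx'⟩, hA'⟩
        obtain rfl := Part.mem_unique hchart hy
        exact ⟨x', ⟨z', ⟨z, hyz, hzz'⟩, hx'⟩, hA'⟩
      · rintro ⟨x', ⟨z', ⟨z, hyz, hzz'⟩, hx'⟩, hA'⟩
        exact ⟨x', ⟨z', ⟨z, ⟨x, hchart, hyz⟩, hzz'⟩, hx'⟩, hA'⟩
    rw [this]
    simp only [mem_comp_twist_iff j c hxc, hQ _ le_rfl, ← hsum0]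
    constructor
    · rintro ⟨_, ⟨h, rfl⟩, h'⟩
      exact ⟨h, h'⟩
    · rintro ⟨h, h'⟩
      exact ⟨_, ⟨h, rfl⟩, h'⟩
  rw [hmain]
  refine and_congr_right fun hne => ?_
  set x' := x * yRoot j (((c : ℂ) - 1) * (weightedSum A c (j + 1) 0)⁻¹) with hx'
  have hminor : ∀ m d, m + d ≤ r + 1 → solidMinor (entries x') m d = (seedCoord A m d : ℂˣ) *
      if d = j + 1 then weightedSum A c (j + 1) m / weightedSum A c (j + 1) 0 else 1 := by
    intro m d hmd
    rw [hx', entries_mul_yRoot]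
    split_ifs with hd
    · subst hd
      have h1 := hxA m _ hmd
      have h2 := hQ m (by omega)
      rw [div_eq_iff (by rw [h1]; exact Units.ne_zero _)] at h2
      rw [solidMinor_add_col, h2, h1, hsum m (by omega)]
      field_simp
    · rw [solidMinor_add_col_of_ne _ _ _ _ _ hd, hxA m d hmd, mul_one]
  constructor
  · intro h m d hp
    have := ((mem_chartInv_iff _ _).1 h).2 m d hp.2.2
    rw [hminor m d hp.2.2, seedCoord_of_isSeedPlace _ hp, seedCoord_of_isSeedPlace _ hp] at this
    exact this.symm
  · intro h
    have hx'l : x' ∈ lowerB r := lowerB_mul hxl (yRoot_mem_lowerN _ _).1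
    refine (mem_chartInv_iff _ _).2 ⟨mem_cell_of_solidMinor_ne_zero hx'l fun d hd => ?_,
      fun m d hmd => ?_⟩
    · rw [hminor _ _ (by omega)]
      refine mul_ne_zero (Units.ne_zero _) ?_
      split_ifs with hd
      · refine div_ne_zero ?_ hne
        rw [hsum _ (by omega), show r + 1 - d = r - (j : ℕ) by omega, ← hsum0]
        rw [show weightedSum A c (j + 1) 0 + (c - 1) * weightedSum A c (j + 1) 0 =
          c * weightedSum A c (j + 1) 0 by ring]
        exact mul_ne_zero c.ne_zero hne
      · exact one_ne_zero
    · rw [hminor m d hmd]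
      by_cases hp : IsSeedPlace r m d
      · rw [seedCoord_of_isSeedPlace _ hp, seedCoord_of_isSeedPlace _ hp, h m d hp]
      · have h0 : d ≠ j + 1 := fun hd => hp ⟨by omega, by omega, hmd⟩
        simp [seedCoord, hp, h0]

/-! ### The domain of the action -/

theorem weightedSum_eq_sum (A : SeedIndex (longWord r) → ℂˣ) (c : ℂ) {d m : ℕ}
    (hm : m ≤ r - d + 1) :
    weightedSum A c d m = ∑ s ∈ Finset.Icc 1 (r - d + 1),
      (if s ≤ m then c else 1) * stepRatio (fun m d => (seedCoord A m d : ℂˣ)) d s := by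
  have h1 : ∀ a b : ℕ, Finset.Icc a b = Finset.Ico a (b + 1) := fun a b => by
    ext; simp
  rw [weightedSum, h1, h1, h1, ← Finset.sum_Ico_consecutive _ (show 1 ≤ m + 1 by omega)
    (show m + 1 ≤ r - d + 1 + 1 by omega), Finset.mul_sum]
  congr 1
  · refine Finset.sum_congr rfl fun s hs => ?_
    rw [Finset.mem_Ico] at hs
    rw [if_pos (by omega)]
  · refine Finset.sum_congr rfl fun s hs => ?_
    rw [Finset.mem_Ico] at hs
    rw [if_neg (by omega), one_mul]

/-- The numerator of `weightedSum`, as a polynomial in the cluster coordinates. -/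
noncomputable def weightedPoly (r : ℕ) (c : ℂ) (d m : ℕ) :
    MvPolynomial (SeedIndex (longWord r)) ℂ :=
  ∑ s ∈ Finset.Icc 1 (r - d + 1), MvPolynomial.C (if s ≤ m then c else 1) *
    (seedCoord MvPolynomial.X (s - 1) (d + 1) * seedCoord MvPolynomial.X s (d - 1) *
      ∏ l ∈ ((Finset.range (r - d + 2)).erase s).erase (s - 1), seedCoord MvPolynomial.X l d)

theorem eval_weightedPoly (B : SeedIndex (longWord r) → ℂ) (c : ℂ) (d m : ℕ) :
    MvPolynomial.eval B (weightedPoly r c d m) =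
      ∑ s ∈ Finset.Icc 1 (r - d + 1), (if s ≤ m then c else 1) *
        (seedCoord B (s - 1) (d + 1) * seedCoord B s (d - 1) *
          ∏ l ∈ ((Finset.range (r - d + 2)).erase s).erase (s - 1), seedCoord B l d) := by
  have h : ∀ m d, MvPolynomial.eval B (seedCoord MvPolynomial.X m d) = seedCoord B m d := by
    intro m d
    rw [map_seedCoord (MvPolynomial.eval B) (map_one _)]
    simp
  simp [weightedPoly, map_sum, map_mul, map_prod, h]

theorem eval_weightedPoly_units (A : SeedIndex (longWord r) → ℂˣ) (c : ℂ) {d m : ℕ}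
    (hm : m ≤ r - d + 1) :
    MvPolynomial.eval (fun k => (A k : ℂ)) (weightedPoly r c d m) =
      (∏ l ∈ Finset.range (r - d + 2), ((seedCoord A l d : ℂˣ) : ℂ)) * weightedSum A c d m := by
  rw [eval_weightedPoly, weightedSum_eq_sum A c hm, Finset.mul_sum]
  refine Finset.sum_congr rfl fun s hs => ?_
  rw [Finset.mem_Icc] at hs
  simp only [← map_seedCoord Units.val Units.val_one A]
  rw [← Finset.mul_prod_erase (Finset.range (r - d + 2)) _ (show s ∈ _ by simp; omega),
    ← Finset.mul_prod_erase ((Finset.range (r - d + 2)).erase s) _ (show s - 1 ∈ _ by simp; omega)]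
  simp only [stepRatio]
  field_simp

theorem weightedPoly_ne_zero {c : ℂ} (hc : c ≠ 0) {d m : ℕ} (hd : 1 ≤ d) (hdr : d ≤ r) :
    weightedPoly r c d m ≠ 0 := by
  -- At the point whose coordinates with the letter `d + 1` vanish, except for the one with the index
  -- `-(d + 1)`, only the summand for `s = 1` survives.
  set B : SeedIndex (longWord r) → ℂ := fun k =>
    if 0 < num (longWord r) k ∧ (letter (longWord r) k : ℕ) = d then 0 else 1 with hB
  have h1 : ∀ m e, e ≠ d + 1 → seedCoord B m e = 1 := by
    intro m e he
    by_cases hp : IsSeedPlace r m e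
    · rw [seedCoord_of_isSeedPlace _ hp]
      refine if_neg fun h => he ?_
      have := letter_seedIndex hp
      have := hp.1
      omega
    · exact dif_neg hp
  have h2 : seedCoord B 0 (d + 1) = 1 := by
    by_cases hp : IsSeedPlace r 0 (d + 1)
    · rw [seedCoord_of_isSeedPlace _ hp]
      refine if_neg fun h => ?_
      rw [num_seedIndex_zero] at h
      omega
    · exact dif_neg hp
  have h3 : ∀ m, 1 ≤ m → m + d ≤ r → seedCoord B m (d + 1) = 0 := by
    intro m hm hmd
    have hp : IsSeedPlace r m (d + 1) := ⟨by omega, by omega, by omega⟩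
    rw [seedCoord_of_isSeedPlace _ hp]
    refine if_pos ⟨?_, by rw [letter_seedIndex]; omega⟩
    rw [num_seedIndex (by omega)]
    omega
  intro h0
  have h := eval_weightedPoly B c d m
  rw [h0, map_zero, Finset.sum_eq_single 1] at h
  · rw [h1 1 (d - 1) (by omega), h2, Finset.prod_eq_one fun l _ => h1 l d (by omega)] at h
    split_ifs at h
    · exact hc (by simpa using h.symm)
    · simp at h
  · intro s hs hs1
    rw [Finset.mem_Icc] at hs
    rw [h3 (s - 1) (by omega) (by omega)]
    simp
  · intro h1
    simp at h1

theorem genericallyDefined_twistedAction (j : Fin r) (c : ℂˣ) :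
    GenericallyDefined (twistedAction (longWord r) j c) := by
  refine ⟨∏ m ∈ Finset.range (r - j + 1), weightedPoly r c (j + 1) m,
    Finset.prod_ne_zero_iff.2 fun m _ => weightedPoly_ne_zero c.ne_zero (by omega) (by omega),
    fun A hA => ?_⟩
  rw [map_prod, Finset.prod_ne_zero_iff] at hA
  have hW : ∀ m ≤ r - (j : ℕ), weightedSum A c (j + 1) m ≠ 0 := by
    intro m hm h0
    refine hA m (by simp; omega) ?_
    rw [eval_weightedPoly_units A c (by omega), h0, mul_zero]
  have hk : ∀ k : SeedIndex (longWord r), ∃ a : ℂˣ, ∀ m d (h : IsSeedPlace r m d),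
      k = seedIndex r m d h → (a : ℂ) = A k *
        if d = j + 1 then weightedSum A c (j + 1) m / weightedSum A c (j + 1) 0 else 1 := by
    intro k
    obtain ⟨m, d, h, rfl⟩ := exists_seedIndex k
    have h0 : (A (seedIndex r m d h) : ℂ) *
        (if d = j + 1 then weightedSum A c (j + 1) m / weightedSum A c (j + 1) 0 else 1) ≠ 0 := by
      refine mul_ne_zero (Units.ne_zero _) ?_
      split_ifs with hd
      · have := h.2.2
        exact div_ne_zero (hW _ (by omega)) (hW _ (by omega))
      · exact one_ne_zero
    refine ⟨Units.mk0 _ h0, fun m' d' h' he => ?_⟩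
    obtain ⟨rfl, rfl⟩ := (seedIndex_eq_iff _ _).1 he
    rfl
  choose A' hA' using hk
  exact Part.dom_iff_mem.2 ⟨A', (mem_twistedAction_iff A A' j c).2
    ⟨hW 0 (by omega), fun m d h => hA' _ m d h rfl⟩⟩

end GeoCrystal

theorem theorem7p3 (r : ℕ) (j : Fin r) (c : ℂˣ) :
    GeoCrystal.GenericallyDefined
        (GeoCrystal.twistedAction (GeoCrystal.longWord r) j c) ∧
      ∀ A A' : GeoCrystal.SeedIndex (GeoCrystal.longWord r) → ℂˣ,
        A' ∈ GeoCrystal.twistedAction (GeoCrystal.longWord r) j c A →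
        ∀ m d : ℕ, 1 ≤ m → 1 ≤ d → m + d ≤ r + 1 →
          ((j : ℕ) + 1 = d →
            ∑ s ∈ Finset.Icc 1 (r - d + 1),
                GeoCrystal.tailProd (GeoCrystal.ensembleMap (GeoCrystal.longWord r) A) d s ≠ 0 ∧
            GeoCrystal.coord A' m d = GeoCrystal.coord A m d *
              (((c : ℂ) * ∑ s ∈ Finset.Icc 1 m,
                    GeoCrystal.tailProd (GeoCrystal.ensembleMap (GeoCrystal.longWord r) A) d s +
                  ∑ s ∈ Finset.Icc (m + 1) (r - d + 1),
                    GeoCrystal.tailProd (GeoCrystal.ensembleMap (GeoCrystal.longWord r) A) d s) /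
                ∑ s ∈ Finset.Icc 1 (r - d + 1),
                  GeoCrystal.tailProd (GeoCrystal.ensembleMap (GeoCrystal.longWord r) A) d s)) ∧
          ((j : ℕ) + 1 ≠ d → GeoCrystal.coord A' m d = GeoCrystal.coord A m d) := by
  refine ⟨GeoCrystal.genericallyDefined_twistedAction j c, fun A A' hA' m d hm hd hmd => ?_⟩
  obtain ⟨h0, h⟩ := (GeoCrystal.mem_twistedAction_iff A A' j c).1 hA'
  have hp : GeoCrystal.IsSeedPlace r m d := ⟨hd, by omega, hmd⟩
  have hv := h m d hp
  have hc : ∀ A, GeoCrystal.coord A m d = A (GeoCrystal.seedIndex r m d hp) := fun A => by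
    rw [GeoCrystal.coord_eq_seedCoord A hm hd hmd, GeoCrystal.seedCoord_of_isSeedPlace]
  rw [← hc, ← hc] at hv
  refine ⟨?_, fun hne => by rw [hv, if_neg (Ne.symm hne), mul_one]⟩
  rintro rfl
  rw [if_pos rfl] at hv
  -- The quotients `P_s ⋯ P_{r-d}` are the monomials `stepRatio` up to the common factor `q⁻¹`.
  set q := GeoCrystal.stepRatio (fun m d => (GeoCrystal.seedCoord A m d : ℂˣ)) (j + 1)
    (r - (j + 1) + 1) with hq
  have hq0 : q ≠ 0 := GeoCrystal.stepRatio_ne_zero A _ _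
  have hsum : ∀ a b : ℕ, 1 ≤ a → b ≤ r - (j + 1) + 1 → ∑ s ∈ Finset.Icc a b,
      GeoCrystal.tailProd (GeoCrystal.ensembleMap (GeoCrystal.longWord r) A) (j + 1) s =
        (∑ s ∈ Finset.Icc a b, GeoCrystal.stepRatio
          (fun m d => (GeoCrystal.seedCoord A m d : ℂˣ)) (j + 1) s) / q := by
    intro a b ha hb
    rw [Finset.sum_div]
    refine Finset.sum_congr rfl fun s hs => ?_
    rw [Finset.mem_Icc] at hs
    exact GeoCrystal.tailProd_ensembleMap A hd (by omega) (by omega)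
  rw [hsum 1 _ le_rfl le_rfl, hsum 1 m le_rfl (by omega), hsum (m + 1) _ (by omega) le_rfl, hv]
  have hw0 : GeoCrystal.weightedSum A c (j + 1) 0 = ∑ s ∈ Finset.Icc 1 (r - (j + 1) + 1),
      GeoCrystal.stepRatio (fun m d => (GeoCrystal.seedCoord A m d : ℂˣ)) (j + 1) s := by
    simp [GeoCrystal.weightedSum]
  rw [← hw0]
  refine ⟨div_ne_zero h0 hq0, ?_⟩
  rw [mul_div_assoc' (c : ℂ), ← add_div, div_div_div_cancel_right₀ hq0]
  rfl
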